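/- Let $M$ be a smooth surface (two-dimensional manifold without boundary) with a transversely oriented foliation $\mathcal F$ by curves, of class $C^r$ with $r\ge 3$. For a Riemannian metric $g$ on $M$ let $\nabla$ be its Levi-Civita connection and $N$ the positively oriented $g$-unit normal to $\mathcal F$; write $\hat X=X-g(X,N)N$ for the $\mathcal F$-component of a vector and $\hat g(X,Y)=g(\hat X,\hat Y)$, and let $\lambda$ be the geodesic curvature of the leaves with respect to $N$, i.e. $-\nabla_XN=\lambda X$ for $X$ tangent to $\mathcal F$. Let $\psi\in C^2(\mathbb R^2)$ and let $(g_t)_{0\le t<\varepsilon}$ be a family of Riemannian metrics on $M$, of class $C^2$ on $[0,\varepsilon)\times M$, which is an extrinsic geometric flow of type (b), that is, $$\partial_t g_t=\psi(\lambda_t,t)\,\hat g_t\qquad(0\le t<\varepsilon),$$ where $\lambda_t$ and $\hat g_t$ are the geodesic curvature of the leaves and the truncated metric of $g_t$. Let $N$ be the positively oriented $g_0$-unit normal to $\mathcal F$ (which is also the one for every $g_t$) and $\nabla^0$ the Levi-Civita connection of $g_0$. Then for all $t\in[0,\varepsilon)$ the Gaussian curvature $K_t$ of $g_t$ is, at every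 point of $M$, $$K_t=\operatorname{div}_{g_t}\!\Big(e^{-\int_0^t\psi(\lambda_s,s)\,ds}\,\nabla^0_NN\Big)+N(\lambda_t)-\lambda_t^2 .$$ -/

import Mathlib

open Set Filter Topology Bundle Manifold
open scoped Manifold ContDiff Topology

noncomputable section

namespace FoliatedSurface

/-- The model plane `ℝ²` with its Euclidean norm. -/
abbrev Plane : Type := EuclideanSpace ℝ (Fin 2)

/-! ### Riemannian geometry of a surface -/

section Riemannian

variable {M : Type*} [TopologicalSpace M] [ChartedSpace Plane M] [IsManifold (𝓡 2) ∞ M]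

variable (M) in
/-- Riemannian metrics of class `C²` on the surface `M`. -/
abbrev Metric : Type _ :=
  Bundle.ContMDiffRiemannianMetric (𝓡 2) 2 Plane (fun p : M ↦ TangentSpace (𝓡 2) p)

variable (M) in
/-- (Not necessarily continuous) vector fields on `M`. -/
abbrev VField : Type _ := (p : M) → TangentSpace (𝓡 2) p

/-- The `i`-th coordinate vector field of the preferred chart of `M` at `p`
(defined near `p`, junk outside of the domain of the chart). -/
def coordField (p : M) (i : Fin 2) : VField M := fun q ↦
  (trivializationAt Plane (TangentSpace (𝓡 2)) p).symm q (EuclideanSpace.single i (1 : ℝ))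

/-- The `i`-th component of the vector field `Y` in the preferred chart of `M` at `p`. -/
def coordComp (p : M) (Y : VField M) (i : Fin 2) : M → ℝ := fun q ↦
  (trivializationAt Plane (TangentSpace (𝓡 2)) p ⟨q, Y q⟩).2 i

/-- The `i`-th coordinate of a vector at `p`, in the preferred chart of `M` at `p`. -/
def coordL (p : M) (i : Fin 2) : TangentSpace (𝓡 2) p →L[ℝ] ℝ :=
  (EuclideanSpace.proj i : Plane →L[ℝ] ℝ).comp
    ((trivializationAt Plane (TangentSpace (𝓡 2)) p).continuousLinearMapAt ℝ p)

/-- The coefficients `g_{ij}` of the metric in the preferred chart of `M` at `p`. -/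
def gram (g : Metric M) (p q : M) (i j : Fin 2) : ℝ :=
  g.inner q (coordField p i q) (coordField p j q)

/-- The derivative `∂_k g_{ij}` at `p`, in the preferred chart of `M` at `p`. -/
def dGram (g : Metric M) (p : M) (k i j : Fin 2) : ℝ :=
  mvfderiv (𝓡 2) (fun q ↦ gram g p q i j) p (coordField p k p)

/-- The Christoffel symbol
`Γ^k_{ij} = ½ ∑ₗ g^{kl} (∂_i g_{jl} + ∂_j g_{il} - ∂_l g_{ij})` at `p`,
in the preferred chart of `M` at `p`. -/
def christoffel (g : Metric M) (p : M) (k i j : Fin 2) : ℝ :=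
  (1 / 2) * ∑ l, (Matrix.of (gram g p p))⁻¹ k l * (dGram g p i j l + dGram g p j i l - dGram g p l i j)

/-- The Levi-Civita connection of `g`: `nabla g Y p v` is `∇_v Y`, whose `k`-th component is
`v(Y^k) + ∑ᵢⱼ Γ^k_{ij} v^i Y^j` (in the preferred chart at `p`). -/
def nabla (g : Metric M) (Y : VField M) (p : M) :
    TangentSpace (𝓡 2) p →L[ℝ] TangentSpace (𝓡 2) p :=
  ∑ k, ContinuousLinearMap.smulRight
    (mvfderiv (𝓡 2) (coordComp p Y k) p +
      ∑ i, ∑ j, (christoffel g p k i j * coordComp p Y j p) • coordL p i)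
    (coordField p k p)

/-- The divergence of a vector field: `div V = tr (v ↦ ∇_v V)`. -/
def divergence (g : Metric M) (V : VField M) (p : M) : ℝ :=
  LinearMap.trace ℝ (TangentSpace (𝓡 2) p) (nabla g V p).toLinearMap

/-- The curvature `R(X,Y)Z = ∇_X ∇_Y Z - ∇_Y ∇_X Z - ∇_{[X,Y]} Z`. -/
def curvature (g : Metric M) (X Y Z : VField M) (p : M) : TangentSpace (𝓡 2) p :=
  nabla g (fun q ↦ nabla g Z q (Y q)) p (X p)
    - nabla g (fun q ↦ nabla g Z q (X q)) p (Y p)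
    - nabla g Z p (VectorField.mlieBracket (𝓡 2) X Y p)

/-- The Gaussian curvature
`K = g(R(X,Y)Y,X) / (g(X,X) g(Y,Y) - g(X,Y)²)` at `p`, computed with the coordinate fields `X`, `Y`
of the preferred chart of `M` at `p`. -/
def gaussCurvature (g : Metric M) (p : M) : ℝ :=
  g.inner p (curvature g (coordField p 0) (coordField p 1) (coordField p 1) p) (coordField p 0 p) /
    (Matrix.of (gram g p p)).det

end Riemannian

/-! ### Foliations by curves -/

section Foliation

variable {M : Type*} [TopologicalSpace M] [ChartedSpace Plane M]

/-- The chart `φ` of `M` is foliated for the family `leaves`: for every leaf `L` meeting the domain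
`U` of `φ`, the connected components of `φ (U ∩ L)` are the slices `x₂ = c`. -/
def IsFoliatedChart (leaves : Set (Set M)) (φ : OpenPartialHomeomorph M Plane) : Prop :=
  ∀ L ∈ leaves, ∀ q ∈ φ.source ∩ L,
    connectedComponentIn (φ '' (φ.source ∩ L)) (φ q) = {y ∈ φ.target | y 1 = φ q 1}

variable (M) in
/-- A one-dimensional foliation of class `C^r` of the surface `M`. -/
structure Foliation (r : WithTop ℕ∞) where
  /-- The leaves. -/
  leaves : Set (Set M)
  isConnected : ∀ L ∈ leaves, IsConnected L
  iUnion_leaves : ⋃₀ leaves = univ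
  disjoint : leaves.PairwiseDisjoint id
  exists_chart : ∀ p : M, ∃ φ ∈ IsManifold.maximalAtlas (𝓡 2) r M,
    p ∈ φ.source ∧ φ p = 0 ∧ IsFoliatedChart leaves φ

/-- The tangent bundle `Tℱ ⊆ TM` of the foliation: the velocities of the `C¹` curves lying in a
leaf. -/
def Foliation.tangent {r : WithTop ℕ∞} (ℱ : Foliation M r) : Set (TangentBundle (𝓡 2) M) :=
  {w | ∃ L ∈ ℱ.leaves, ∃ γ : ℝ → M, ContMDiffAt 𝓘(ℝ, ℝ) (𝓡 2) 1 γ 0 ∧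
    (∀ᶠ s in 𝓝 (0 : ℝ), γ s ∈ L) ∧ w = ⟨γ 0, mfderiv 𝓘(ℝ, ℝ) (𝓡 2) γ 0 (1 : ℝ)⟩}

/-- A transverse orientation of a foliation by curves of a surface, given by a continuous vector
field transverse to the leaves, which points to the positive side of the leaves. -/
structure TransverseOrientation {r : WithTop ℕ∞} [IsManifold (𝓡 2) ∞ M] (ℱ : Foliation M r) where
  /-- The transverse vector field. -/
  field : VField M
  continuous_field : Continuous fun p ↦ (⟨p, field p⟩ : TangentBundle (𝓡 2) M)
  transverse : ∀ p, (⟨p, field p⟩ : TangentBundle (𝓡 2) M) ∉ ℱ.tangent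

end Foliation

/-! ### Extrinsic geometry of the leaves and the flow -/

section EGF

variable {M : Type*} [TopologicalSpace M] [ChartedSpace Plane M] [IsManifold (𝓡 2) ∞ M]
  {r : WithTop ℕ∞} {ℱ : Foliation M r}

/-- `N` is the positively oriented unit normal of the foliation for the metric `g`. -/
structure IsUnitNormal (o : TransverseOrientation ℱ) (g : Metric M) (N : VField M) : Prop where
  unit : ∀ p, g.inner p (N p) (N p) = 1
  normal : ∀ w ∈ ℱ.tangent, g.inner w.1 (N w.1) w.2 = 0
  positive : ∀ p, 0 < g.inner p (N p) (o.field p)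

/-- The component `X̂ = X - g(X,N) N` of a vector along the foliation with unit normal `N`. -/
def hat (g : Metric M) (N : VField M) (p : M) :
    TangentSpace (𝓡 2) p →L[ℝ] TangentSpace (𝓡 2) p :=
  ContinuousLinearMap.id ℝ (TangentSpace (𝓡 2) p) - (g.inner p (N p)).smulRight (N p)

/-- The Weingarten operator `A X = -∇_X N` for `X` tangent to the leaves, extended by `A N = 0`. -/
def weingarten (g : Metric M) (N : VField M) (p : M) :
    TangentSpace (𝓡 2) p →L[ℝ] TangentSpace (𝓡 2) p :=
  -((nabla g N p).comp (hat g N p))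

/-- The geodesic curvature `λ` of the leaves with respect to `N`, that is, the only principal
curvature of the leaves: `λ = τ₁ = tr A`. -/
def geodCurvature (g : Metric M) (N : VField M) (p : M) : ℝ :=
  LinearMap.trace ℝ (TangentSpace (𝓡 2) p) (weingarten g N p).toLinearMap

/-- The family `g t`, `t ∈ [0, ε)`, of Riemannian metrics on the foliated surface, with the positive
unit normals `N t`, is an extrinsic geometric flow of type (b) with the function `ψ`: it is of class
`C²` on `[0, ε) × M` and `∂ₜ g_t = ψ(λ_t, t) ĝ_t`, where `ĝ_t(u, v) = g_t(û, v̂)`. -/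
structure IsEGF (o : TransverseOrientation ℱ) (ψ : ℝ × ℝ → ℝ) (ε : ℝ) (g : ℝ → Metric M)
    (N : ℝ → VField M) : Prop where
  contMDiffOn : ContMDiffOn (𝓘(ℝ, ℝ).prod (𝓡 2)) ((𝓡 2).prod 𝓘(ℝ, Plane →L[ℝ] Plane →L[ℝ] ℝ)) 2
    (fun q : ℝ × M ↦ (TotalSpace.mk' (Plane →L[ℝ] Plane →L[ℝ] ℝ) q.2 ((g q.1).inner q.2) :
      TotalSpace (Plane →L[ℝ] Plane →L[ℝ] ℝ)
        (fun p : M ↦ TangentSpace (𝓡 2) p →L[ℝ] TangentSpace (𝓡 2) p →L[ℝ] ℝ)))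
    (Ico 0 ε ×ˢ univ)
  isUnitNormal : ∀ t ∈ Ico 0 ε, IsUnitNormal o (g t) (N t)
  hasDerivWithinAt : ∀ t ∈ Ico 0 ε, ∀ (p : M) (u v : TangentSpace (𝓡 2) p),
    HasDerivWithinAt (fun s ↦ (g s).inner p u v)
      (ψ (geodCurvature (g t) (N t) p, t) *
        (g t).inner p (hat (g t) (N t) p u) (hat (g t) (N t) p v)) (Ico 0 ε) t

end EGF

end FoliatedSurface

end

/-!
A local `g`-orthonormal frame `T`, `N`, with `T` tangent to the leaves, has a connection form
`θ = g(∇ T, N)`, and `K = -dθ(T, N)`. Since `θ(T) = λ` and `∇_N N = -θ(N) T`, expanding `dθ(T, N)`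
yields the static identity `K = div(∇_N N) + N(λ) - λ²` for a single metric.

Along the flow, with speed `P`, the form `g_t(U, ·)` is multiplied by `e^{∫ P}` for `U` tangent to
the leaves while `g_t(N, ·)` does not change, so that `N` is the unit normal of every `g_t`. As
`g_t(U, ∇_N N) = -g_t(N, ∇_N U) = -g_t(N, [N, U])` does not depend on `t`, the field `∇_N N` is
multiplied by `e^{-∫ P}`.
-/

noncomputable section

namespace FoliatedSurface

lemma eq_exp_integral_smul {E : Type*} [NormedAddCommGroup E] [NormedSpace ℝ E] {P : ℝ → ℝ}
    {f : ℝ → E} {a b : ℝ} (hab : a ≤ b) (hP : ContinuousOn P (Icc a b))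
    (hf : ∀ s ∈ Icc a b, HasDerivWithinAt f (P s • f s) (Icc a b) s) :
    f b = Real.exp (∫ s in a..b, P s) • f a := by
  let Q : ℝ → ℝ := IccExtend hab fun s ↦ P s
  have hQ : Continuous Q := hP.domRestrict.Icc_extend'
  have hQP {s : ℝ} (hs : s ∈ Icc a b) : Q s = P s := IccExtend_of_mem hab _ hs
  let F : ℝ → E := fun s ↦ Real.exp (-∫ x in a..s, Q x) • f s
  have hF (s : ℝ) (hs : s ∈ Icc a b) : HasDerivWithinAt F 0 (Icc a b) s := by
    have h_exp := (hQ.integral_hasStrictDerivAt a s).hasDerivAt.fun_neg.exp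
    refine (h_exp.hasDerivWithinAt.smul (hf s hs)).congr_deriv ?_
    rw [hQP hs]
    module
  have h_const : F b = F a := by
    refine constant_of_derivWithin_zero (fun s hs ↦ (hF s hs).differentiableWithinAt)
      (fun s hs ↦ ?_) b (right_mem_Icc.2 hab)
    exact (hF s (Ico_subset_Icc_self hs)).derivWithin
      (uniqueDiffOn_Icc (hs.1.trans_lt hs.2) s (Ico_subset_Icc_self hs))
  have h_integral : ∫ s in a..b, P s = ∫ s in a..b, Q s :=
    intervalIntegral.integral_congr fun s hs ↦ (hQP (by rwa [uIcc_of_le hab] at hs)).symm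
  simp only [F, intervalIntegral.integral_same, neg_zero, Real.exp_zero, one_smul] at h_const
  rw [h_integral, ← h_const, smul_smul, ← Real.exp_add, add_neg_cancel, Real.exp_zero, one_smul]

/-! ### One-forms and their exterior derivative -/

section OneForm

variable {E : Type*} [NormedAddCommGroup E] [NormedSpace ℝ E] {H : Type*} [TopologicalSpace H]
  {I : ModelWithCorners ℝ E H} {M : Type*} [TopologicalSpace M] [ChartedSpace H M]
  {α β : (q : M) → TangentSpace I q →L[ℝ] ℝ} {f : M → ℝ}
  {U V X Y Z : (q : M) → TangentSpace I q} {p : M}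

lemma mvfderiv_congr {h : M → ℝ} (H : f =ᶠ[𝓝 p] h) : d% f p = d% h p := by
  have h_mfderiv : mfderiv I 𝓘(ℝ, ℝ) f p = mfderiv I 𝓘(ℝ, ℝ) h p := H.mfderiv_eq
  ext v
  exact congrArg (fun L ↦ L v) h_mfderiv

variable (I) in
/-- The exterior derivative `dα(X, Y) = X(α(Y)) - Y(α(X)) - α([X, Y])` of the one-form `α`, as a
function of the vector fields `X`, `Y` rather than of their values at `p`. -/
def oneFormDeriv (α : (q : M) → TangentSpace I q →L[ℝ] ℝ) (X Y : (q : M) → TangentSpace I q)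
    (p : M) : ℝ :=
  d% (fun q ↦ α q (Y q)) p (X p) - d% (fun q ↦ α q (X q)) p (Y p) -
    α p (VectorField.mlieBracket I X Y p)

lemma oneFormDeriv_swap : oneFormDeriv I α X Y p = -oneFormDeriv I α Y X p := by
  simp only [oneFormDeriv, VectorField.mlieBracket_swap_apply (V := X), map_neg]
  ring

section

variable [IsManifold I 1 M]

variable (I) in
/-- Differentiability at `p` of the one-form `α`, tested on the vector fields differentiable at
`p`. -/
def OneFormDiffAt (α : (q : M) → TangentSpace I q →L[ℝ] ℝ) (p : M) : Prop :=
  ∀ ⦃Y : (q : M) → TangentSpace I q⦄, MDiffAt (T% Y) p → MDiffAt (fun q ↦ α q (Y q)) p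

lemma OneFormDiffAt.smul (hf : MDiffAt f p) (hα : OneFormDiffAt I α p) :
    OneFormDiffAt I (f • α) p :=
  fun _ hY ↦ hf.mul (hα hY)

lemma OneFormDiffAt.add (hα : OneFormDiffAt I α p) (hβ : OneFormDiffAt I β p) :
    OneFormDiffAt I (α + β) p :=
  fun _ hY ↦ (hα hY).add (hβ hY)

lemma OneFormDiffAt.sub (hα : OneFormDiffAt I α p) (hβ : OneFormDiffAt I β p) :
    OneFormDiffAt I (α - β) p :=
  fun _ hY ↦ (hα hY).sub (hβ hY)

lemma oneFormDeriv_add (hα : OneFormDiffAt I α p) (hβ : OneFormDiffAt I β p)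
    (hX : MDiffAt (T% X) p) (hY : MDiffAt (T% Y) p) :
    oneFormDeriv I (α + β) X Y p = oneFormDeriv I α X Y p + oneFormDeriv I β X Y p := by
  have h {Z : (q : M) → TangentSpace I q} (hZ : MDiffAt (T% Z) p) :
      d% (fun q ↦ (α + β) q (Z q)) p = d% (fun q ↦ α q (Z q)) p + d% (fun q ↦ β q (Z q)) p :=
    mvfderiv_add (hα hZ) (hβ hZ)
  rw [oneFormDeriv, h hX, h hY]
  simp only [oneFormDeriv, Pi.add_apply, add_apply]
  ring

lemma oneFormDeriv_sub (hα : OneFormDiffAt I α p) (hβ : OneFormDiffAt I β p)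
    (hX : MDiffAt (T% X) p) (hY : MDiffAt (T% Y) p) :
    oneFormDeriv I (α - β) X Y p = oneFormDeriv I α X Y p - oneFormDeriv I β X Y p := by
  have h {Z : (q : M) → TangentSpace I q} (hZ : MDiffAt (T% Z) p) :
      d% (fun q ↦ (α - β) q (Z q)) p = d% (fun q ↦ α q (Z q)) p - d% (fun q ↦ β q (Z q)) p :=
    mvfderiv_sub (hα hZ) (hβ hZ)
  rw [oneFormDeriv, h hX, h hY]
  simp only [oneFormDeriv, Pi.sub_apply, sub_apply]
  ring

lemma oneFormDeriv_smul (hf : MDiffAt f p) (hα : OneFormDiffAt I α p)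
    (hX : MDiffAt (T% X) p) (hY : MDiffAt (T% Y) p) :
    oneFormDeriv I (f • α) X Y p =
      f p * oneFormDeriv I α X Y p + d% f p (X p) * α p (Y p) - d% f p (Y p) * α p (X p) := by
  have h {Z : (q : M) → TangentSpace I q} (hZ : MDiffAt (T% Z) p) :
      d% (fun q ↦ (f • α) q (Z q)) p = f p • d% (fun q ↦ α q (Z q)) p + α p (Z p) • d% f p :=
    mvfderiv_mul hf (hα hZ)
  rw [oneFormDeriv, h hX, h hY]
  simp only [oneFormDeriv, Pi.smul_apply', add_apply, smul_apply, smul_eq_mul]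
  ring

end

variable [IsManifold I 2 M]

lemma tensorialAt_oneFormDeriv [CompleteSpace E] (hα : OneFormDiffAt I α p)
    (X : (q : M) → TangentSpace I q) :
    TensorialAt I E (oneFormDeriv I α X · p) p where
  smul {f Y} hf hY := by
    have h : d% (fun q ↦ α q ((f • Y) q)) p =
        f p • d% (fun q ↦ α q (Y q)) p + α p (Y p) • d% f p := by
      rw [← mvfderiv_mul hf (hα hY)]
      congr 1 with q
      simp
    rw [oneFormDeriv, h, VectorField.mlieBracket_smul_right hf hY]
    simp only [oneFormDeriv, Pi.smul_apply', map_add, map_smul, add_apply, smul_apply, smul_eq_mul]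
    ring
  add {Y Z} hY hZ := by
    have h : d% (fun q ↦ α q ((Y + Z) q)) p =
        d% (fun q ↦ α q (Y q)) p + d% (fun q ↦ α q (Z q)) p := by
      rw [← mvfderiv_add (hα hY) (hα hZ)]
      congr 1 with q
      simp
    rw [oneFormDeriv, h, VectorField.mlieBracket_add_right hY hZ]
    simp only [oneFormDeriv, Pi.add_apply, map_add, add_apply]
    ring

lemma oneFormDeriv_eq_of_eq_smul_add_smul [FiniteDimensional ℝ E] (hα : OneFormDiffAt I α p)
    (X : (q : M) → TangentSpace I q) (hU : MDiffAt (T% U) p) (hV : MDiffAt (T% V) p)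
    (hY : MDiffAt (T% Y) p) {a b : ℝ} (h : Y p = a • U p + b • V p) :
    oneFormDeriv I α X Y p = a * oneFormDeriv I α X U p + b * oneFormDeriv I α X V p := by
  have : CompleteSpace E := FiniteDimensional.complete ℝ E
  have hΦ := tensorialAt_oneFormDeriv hα X
  rw [← TensorialAt.mkHom_apply hΦ hY, h, map_add, map_smul, map_smul,
    TensorialAt.mkHom_apply hΦ hU, TensorialAt.mkHom_apply hΦ hV]
  rfl

lemma oneFormDeriv_eq_det_mul [FiniteDimensional ℝ E] (hα : OneFormDiffAt I α p)
    (hU : MDiffAt (T% U) p) (hV : MDiffAt (T% V) p) (hX : MDiffAt (T% X) p)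
    (hY : MDiffAt (T% Y) p) {a b c d : ℝ} (hXp : X p = a • U p + b • V p)
    (hYp : Y p = c • U p + d • V p) :
    oneFormDeriv I α X Y p = (a * d - b * c) * oneFormDeriv I α U V p := by
  have h_self (Z : (q : M) → TangentSpace I q) : oneFormDeriv I α Z Z p = 0 :=
    self_eq_neg.1 oneFormDeriv_swap
  rw [oneFormDeriv_eq_of_eq_smul_add_smul hα X hU hV hY hYp, oneFormDeriv_swap (X := X) (Y := U),
    oneFormDeriv_swap (X := X) (Y := V), oneFormDeriv_eq_of_eq_smul_add_smul hα U hU hV hX hXp,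
    oneFormDeriv_eq_of_eq_smul_add_smul hα V hU hV hX hXp, h_self, h_self,
    oneFormDeriv_swap (X := V)]
  ring

end OneForm

section ConstField

variable {E : Type*} [NormedAddCommGroup E] [NormedSpace ℝ E]

/-- The constant vector field with value `v` on a normed space; the coordinate fields of a chart are
the pullbacks of such fields. -/
def constField (v : E) : (y : E) → TangentSpace 𝓘(ℝ, E) y := fun _ ↦ v

lemma contMDiffAt_constField (v y : E) (n : WithTop ℕ∞) :
    CMDiffAt n (T% (constField v)) y :=
  contMDiffAt_vectorSpace_iff_contDiffAt.2 contDiffAt_const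

lemma mdifferentiableAt_constField (v y : E) : MDiffAt (T% (constField v)) y :=
  (contMDiffAt_constField v y 1).mdifferentiableAt one_ne_zero

lemma mlieBracket_constField (v w y : E) :
    VectorField.mlieBracket 𝓘(ℝ, E) (constField v) (constField w) y = 0 := by
  rw [← VectorField.mlieBracketWithin_univ]
  refine (congrFun VectorField.mlieBracketWithin_eq_lieBracketWithin y).trans ?_
  have h_fderiv (u : E) : fderivWithin ℝ (constField u : E → E) univ y = 0 :=
    fderivWithin_const_apply u
  exact (congrArg₂ (fun A B : E →L[ℝ] E ↦ A v - B w) (h_fderiv w) (h_fderiv v)).trans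
    (sub_self 0)

end ConstField

section Surface

variable {M : Type*} [TopologicalSpace M] [ChartedSpace Plane M]

instance (p : M) : Module.Finite ℝ (TangentSpace (𝓡 2) p) :=
  inferInstanceAs (Module.Finite ℝ Plane)

lemma finrank_tangentSpace (p : M) : Module.finrank ℝ (TangentSpace (𝓡 2) p) = 2 :=
  (finrank_euclideanSpace_fin : Module.finrank ℝ Plane = 2)

lemma eventually_mem_chart_source (p : M) : ∀ᶠ q in 𝓝 p, q ∈ (chartAt Plane p).source :=
  (chartAt Plane p).open_source.mem_nhds (mem_chart_source Plane p)

variable [IsManifold (𝓡 2) ∞ M] {f : M → ℝ} {X Y Z : VField M} {p q : M}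

/-- The vector field `Y` is of class `C^n` at `p`. -/
abbrev VField.ContAt (n : WithTop ℕ∞) (Y : VField M) (p : M) : Prop :=
  ContMDiffAt (𝓡 2) (𝓡 2).tangent n (fun q ↦ (⟨q, Y q⟩ : TangentBundle (𝓡 2) M)) p

/-- The vector field `Y` is differentiable at `p`. -/
abbrev VField.DiffAt (Y : VField M) (p : M) : Prop :=
  MDifferentiableAt (𝓡 2) (𝓡 2).tangent (fun q ↦ (⟨q, Y q⟩ : TangentBundle (𝓡 2) M)) p

lemma VField.ContAt.eventually {n : ℕ} (h : VField.ContAt n Y p) :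
    ∀ᶠ q in 𝓝 p, VField.ContAt n Y q := by
  have : IsManifold (𝓡 2) ((n : WithTop ℕ∞) + 1) M :=
    inferInstanceAs (IsManifold (𝓡 2) ((n + 1 : ℕ) : WithTop ℕ∞) M)
  have : IsManifold (𝓡 2).tangent n (TangentBundle (𝓡 2) M) := inferInstance
  exact (contMDiffAt_iff_contMDiffAt_nhds (by simp)).1 h

lemma isManifold_minSmoothness_two : IsManifold (𝓡 2) (minSmoothness ℝ 2) M := by
  rw [minSmoothness_of_isRCLikeNormedField]
  infer_instance

lemma VField.ContAt.mlieBracket (hX : VField.ContAt 2 X p) (hY : VField.ContAt 2 Y p) :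
    VField.ContAt 1 (VectorField.mlieBracket (𝓡 2) X Y) p := by
  have : IsManifold (𝓡 2) ((2 : ℕ∞) + 1) M := inferInstanceAs (IsManifold (𝓡 2) 3 M)
  have := isManifold_minSmoothness_two (M := M)
  exact ContMDiffAt.mlieBracket_vectorField (n := 2) (m := 1) hX hY
    (by rw [minSmoothness_of_isRCLikeNormedField]; norm_num)

lemma contMDiffAt_inner {n : WithTop ℕ∞} (hn : n ≤ 2) (g : Metric M)
    (hX : VField.ContAt n X p) (hY : VField.ContAt n Y p) :
    ContMDiffAt (𝓡 2) 𝓘(ℝ, ℝ) n (fun q ↦ g.inner q (X q) (Y q)) p :=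
  (Bundle.contMDiffAt_section _).1 <|
    ContMDiffAt.clm_bundle_apply₂ (F₁ := Plane) (F₂ := Plane) (F₃ := ℝ) (E₃ := fun _ ↦ ℝ)
      (b := fun q : M ↦ q) ((g.contMDiff p).of_le hn) hX hY

lemma mdifferentiableAt_inner (g : Metric M) (hX : VField.DiffAt X p) (hY : VField.DiffAt Y p) :
    MDifferentiableAt (𝓡 2) 𝓘(ℝ, ℝ) (fun q ↦ g.inner q (X q) (Y q)) p :=
  (mdifferentiableAt_section _ _).1 <|
    MDifferentiableAt.clm_bundle_apply₂ (F₁ := Plane) (F₂ := Plane) (F₃ := ℝ) (E₃ := fun _ ↦ ℝ)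
      (b := fun q : M ↦ q) ((g.contMDiff p).mdifferentiableAt (by simp)) hX hY

/-! ### Coordinate fields -/

lemma mem_baseSet_trivializationAt (hq : q ∈ (chartAt Plane p).source) :
    q ∈ (trivializationAt Plane (TangentSpace (𝓡 2)) p).baseSet := by
  simpa using hq

lemma trivializationAt_coordField (hq : q ∈ (chartAt Plane p).source) (i : Fin 2) :
    trivializationAt Plane (TangentSpace (𝓡 2)) p ⟨q, coordField p i q⟩ =
      (q, EuclideanSpace.single i (1 : ℝ)) :=
  Trivialization.apply_mk_symm _ (mem_baseSet_trivializationAt hq) _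

lemma continuousLinearMapAt_trivializationAt_apply (hq : q ∈ (chartAt Plane p).source)
    (v : TangentSpace (𝓡 2) q) :
    (trivializationAt Plane (TangentSpace (𝓡 2)) p).continuousLinearMapAt ℝ q v =
      (trivializationAt Plane (TangentSpace (𝓡 2)) p ⟨q, v⟩).2 := by
  rw [Trivialization.continuousLinearMapAt_apply, Trivialization.linearMapAt_apply,
    if_pos (mem_baseSet_trivializationAt hq)]

lemma contAt_coordField (p : M) (i : Fin 2) (n : ℕ∞) : VField.ContAt n (coordField p i) p := by
  have h : ContMDiffOn (𝓡 2) (𝓡 2).tangent ∞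
      (fun q ↦ (⟨q, coordField p i q⟩ : TangentBundle (𝓡 2) M))
      (trivializationAt Plane (TangentSpace (𝓡 2)) p).baseSet := by
    rw [(trivializationAt Plane (TangentSpace (𝓡 2)) p).contMDiffOn_section_baseSet_iff]
    refine (contMDiffOn_const (c := EuclideanSpace.single i (1 : ℝ))).congr fun q hq ↦ ?_
    rw [trivializationAt_coordField (by simpa using hq)]
  refine (h.contMDiffAt ?_).of_le (by exact_mod_cast le_top)
  exact (Trivialization.open_baseSet _).mem_nhds
    (mem_baseSet_trivializationAt (mem_chart_source Plane p))

lemma diffAt_coordField (p : M) (i : Fin 2) : VField.DiffAt (coordField p i) p :=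
  (contAt_coordField p i 1).mdifferentiableAt (by simp)

lemma mdifferentiableAt_coordComp (hY : VField.DiffAt Y p) (i : Fin 2) :
    MDifferentiableAt (𝓡 2) 𝓘(ℝ, ℝ) (coordComp p Y i) p :=
  (EuclideanSpace.proj i : Plane →L[ℝ] ℝ).mdifferentiableAt.comp p <|
    (mdifferentiableAt_section (F := Plane) (𝓡 2) (E := fun q : M ↦ TangentSpace (𝓡 2) q) Y).1 hY

lemma sum_coordComp (hq : q ∈ (chartAt Plane p).source) (Y : VField M) :
    ∑ i, coordComp p Y i q • coordField p i q = Y q := by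
  have hb := mem_baseSet_trivializationAt hq
  set e := trivializationAt Plane (TangentSpace (𝓡 2)) p with he
  have h_coordField (i : Fin 2) :
      coordField p i q = e.symmL ℝ q (EuclideanSpace.single i (1 : ℝ)) :=
    (e.symmL_apply (R := ℝ) hb _).symm
  have h_symm : e.symmL ℝ q (e ⟨q, Y q⟩).2 = Y q := by
    rw [e.symmL_apply hb]
    exact Trivialization.symm_apply_apply_mk e hb (Y q)
  simp_rw [h_coordField, ← map_smul, ← map_sum]
  conv_rhs => rw [← h_symm]
  congr 1
  ext j
  fin_cases j <;> simp [coordComp, he]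

lemma coordComp_self (p : M) (Y : VField M) (i : Fin 2) : coordComp p Y i p = coordL p i (Y p) :=
  congrArg (fun v : Plane ↦ v i)
    (continuousLinearMapAt_trivializationAt_apply (mem_chart_source Plane p) (Y p)).symm

lemma apply_eq_coordL_smul_add (p : M) (Y : VField M) :
    Y p = coordL p 0 (Y p) • coordField p 0 p + coordL p 1 (Y p) • coordField p 1 p := by
  simp only [← coordComp_self, ← Fin.sum_univ_two fun i ↦ coordComp p Y i p • coordField p i p]
  exact (sum_coordComp (mem_chart_source Plane p) Y).symm

lemma coordL_coordField (p : M) (i j : Fin 2) :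
    coordL p i (coordField p j p) = if i = j then 1 else 0 := by
  rw [← coordComp_self, coordComp, trivializationAt_coordField (mem_chart_source Plane p)]
  simp

lemma mfderiv_extChartAt_coordField (hq : q ∈ (chartAt Plane p).source) (i : Fin 2) :
    mfderiv (𝓡 2) 𝓘(ℝ, Plane) (extChartAt (𝓡 2) p) q (coordField p i q) =
      (EuclideanSpace.single i (1 : ℝ) : Plane) := by
  have h := continuousLinearMapAt_trivializationAt_apply hq (coordField p i q)
  rw [trivializationAt_coordField hq, TangentBundle.continuousLinearMapAt_trivializationAt hq] at h
  exact h

lemma coordField_eq_mpullback (hq : q ∈ (chartAt Plane p).source) (i : Fin 2) :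
    coordField p i q = VectorField.mpullback (𝓡 2) 𝓘(ℝ, Plane) (extChartAt (𝓡 2) p)
      (constField (EuclideanSpace.single i (1 : ℝ))) q := by
  have h := isInvertible_mfderiv_extChartAt (I := 𝓡 2) (x := p) (y := q) (by simpa using hq)
  rw [VectorField.mpullback_apply]
  exact (h.inverse_apply_eq.2 (mfderiv_extChartAt_coordField hq i).symm).symm

lemma mlieBracket_coordField (p : M) (i j : Fin 2) :
    VectorField.mlieBracket (𝓡 2) (coordField p i) (coordField p j) p = 0 := by
  have h_pullback (i : Fin 2) :
      coordField p i =ᶠ[𝓝 p] VectorField.mpullback (𝓡 2) 𝓘(ℝ, Plane) (extChartAt (𝓡 2) p)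
        (constField (EuclideanSpace.single i (1 : ℝ))) :=
    (eventually_mem_chart_source p).mono fun q hq ↦ coordField_eq_mpullback hq i
  have := isManifold_minSmoothness_two (M := M)
  have : IsManifold 𝓘(ℝ, Plane) (minSmoothness ℝ 2) Plane := inferInstance
  rw [(h_pullback i).mlieBracket_vectorField_eq (h_pullback j),
    ← VectorField.mpullback_mlieBracket (n := 2) (mdifferentiableAt_constField _ _)
      (mdifferentiableAt_constField _ _) contMDiffAt_extChartAt (by simp),
    VectorField.mpullback_apply, mlieBracket_constField, map_zero]

lemma mvfderiv_coordField_eq (hq : q ∈ (chartAt Plane p).source)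
    (hf : MDifferentiableAt (𝓡 2) 𝓘(ℝ, ℝ) f q) (i : Fin 2) :
    mvfderiv (𝓡 2) f q (coordField p i q) =
      fderiv ℝ (f ∘ (extChartAt (𝓡 2) p).symm) (extChartAt (𝓡 2) p q)
        (EuclideanSpace.single i (1 : ℝ)) := by
  have hs : q ∈ (extChartAt (𝓡 2) p).source := by simpa using hq
  have ht : (extChartAt (𝓡 2) p).target ∈ 𝓝 (extChartAt (𝓡 2) p q) :=
    (isOpen_extChartAt_target p).mem_nhds ((extChartAt (𝓡 2) p).map_source hs)
  have h_eq : f =ᶠ[𝓝 q] (f ∘ (extChartAt (𝓡 2) p).symm) ∘ extChartAt (𝓡 2) p := by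
    filter_upwards [(isOpen_extChartAt_source (I := 𝓡 2) p).mem_nhds hs] with x hx
    simp only [Function.comp_apply, (extChartAt (𝓡 2) p).left_inv hx]
  have h_diff : MDifferentiableAt 𝓘(ℝ, Plane) 𝓘(ℝ, ℝ) (f ∘ (extChartAt (𝓡 2) p).symm)
      (extChartAt (𝓡 2) p q) := by
    refine MDifferentiableAt.comp_of_eq _ hf ?_ ((extChartAt (𝓡 2) p).left_inv hs)
    exact ((contMDiffOn_extChartAt_symm (n := 1) p).contMDiffAt ht).mdifferentiableAt (by simp)
  rw [mvfderiv_congr h_eq, mvfderiv_comp_apply _ h_diff (mdifferentiableAt_extChartAt hq),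
    mfderiv_extChartAt_coordField hq]
  simp only [mvfderiv, mfderiv_eq_fderiv]
  rfl

section SecondOrder

variable (hf : ContMDiffAt (𝓡 2) 𝓘(ℝ, ℝ) 2 f p)
include hf

lemma contDiffAt_comp_extChartAt_symm :
    ContDiffAt ℝ 2 (f ∘ (extChartAt (𝓡 2) p).symm) (extChartAt (𝓡 2) p p) := by
  rw [← contMDiffAt_iff_contDiffAt]
  refine ContMDiffAt.comp_of_eq hf ?_ (extChartAt_to_inv p)
  exact (contMDiffOn_extChartAt_symm (n := 2) p).contMDiffAt (extChartAt_target_mem_nhds p)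

lemma mvfderiv_coordField_eventuallyEq (i : Fin 2) :
    (fun q ↦ mvfderiv (𝓡 2) f q (coordField p i q)) =ᶠ[𝓝 p]
      (fun y ↦ fderiv ℝ (f ∘ (extChartAt (𝓡 2) p).symm) y (EuclideanSpace.single i (1 : ℝ))) ∘
        extChartAt (𝓡 2) p := by
  have h : ∀ᶠ q in 𝓝 p, ContMDiffAt (𝓡 2) 𝓘(ℝ, ℝ) 2 f q :=
    (contMDiffAt_iff_contMDiffAt_nhds (by simp)).1 hf
  filter_upwards [eventually_mem_chart_source p, h] with q hq hfq
  exact mvfderiv_coordField_eq hq (hfq.mdifferentiableAt (by simp)) i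

lemma differentiableAt_fderiv_comp_extChartAt_symm :
    DifferentiableAt ℝ (fderiv ℝ (f ∘ (extChartAt (𝓡 2) p).symm)) (extChartAt (𝓡 2) p p) :=
  ((contDiffAt_comp_extChartAt_symm hf).fderiv_right (m := 1) (by norm_num)).differentiableAt
    one_ne_zero

lemma mdifferentiableAt_mvfderiv_coordField (i : Fin 2) :
    MDifferentiableAt (𝓡 2) 𝓘(ℝ, ℝ) (fun q ↦ mvfderiv (𝓡 2) f q (coordField p i q)) p := by
  refine MDifferentiableAt.congr_of_eventuallyEq ?_ (mvfderiv_coordField_eventuallyEq hf i)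
  refine MDifferentiableAt.comp p ?_ (mdifferentiableAt_extChartAt (mem_chart_source Plane p))
  exact ((differentiableAt_fderiv_comp_extChartAt_symm hf).clm_apply
    (differentiableAt_const _)).mdifferentiableAt

lemma mvfderiv_mvfderiv_coordField_eq (i j : Fin 2) :
    mvfderiv (𝓡 2) (fun q ↦ mvfderiv (𝓡 2) f q (coordField p i q)) p (coordField p j p) =
      fderiv ℝ (fderiv ℝ (f ∘ (extChartAt (𝓡 2) p).symm)) (extChartAt (𝓡 2) p p)
        (EuclideanSpace.single j (1 : ℝ)) (EuclideanSpace.single i (1 : ℝ)) := by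
  have h_diff := differentiableAt_fderiv_comp_extChartAt_symm hf
  have h_fderiv := fderiv_clm_apply h_diff
    (differentiableAt_const (EuclideanSpace.single i (1 : ℝ) : Plane))
  rw [mvfderiv_congr (mvfderiv_coordField_eventuallyEq hf i), mvfderiv_comp_apply _
    (h_diff.clm_apply (differentiableAt_const _)).mdifferentiableAt
    (mdifferentiableAt_extChartAt (mem_chart_source Plane p)),
    mfderiv_extChartAt_coordField (mem_chart_source Plane p)]
  simp only [mvfderiv, mfderiv_eq_fderiv]
  refine (congrArg (fun L : Plane →L[ℝ] ℝ ↦ L (EuclideanSpace.single j (1 : ℝ))) h_fderiv).trans ?_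
  simp

lemma mvfderiv_mvfderiv_coordField_comm (i j : Fin 2) :
    mvfderiv (𝓡 2) (fun q ↦ mvfderiv (𝓡 2) f q (coordField p i q)) p (coordField p j p) =
      mvfderiv (𝓡 2) (fun q ↦ mvfderiv (𝓡 2) f q (coordField p j q)) p (coordField p i p) := by
  simp only [mvfderiv_mvfderiv_coordField_eq hf]
  exact (contDiffAt_comp_extChartAt_symm hf).isSymmSndFDerivAt (by simp) _ _

lemma oneFormDiffAt_mvfderiv : OneFormDiffAt (𝓡 2) (mvfderiv (𝓡 2) f) p := by
  intro Y hY
  have h : (fun q ↦ mvfderiv (𝓡 2) f q (Y q)) =ᶠ[𝓝 p]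
      fun q ↦ ∑ i, coordComp p Y i q * mvfderiv (𝓡 2) f q (coordField p i q) := by
    filter_upwards [eventually_mem_chart_source p] with q hq
    conv_lhs => rw [← sum_coordComp hq Y]
    simp only [map_sum, map_smul, smul_eq_mul]
  refine MDifferentiableAt.congr_of_eventuallyEq ?_ h
  simp only [Fin.sum_univ_two]
  exact ((mdifferentiableAt_coordComp hY 0).mul (mdifferentiableAt_mvfderiv_coordField hf 0)).add
    ((mdifferentiableAt_coordComp hY 1).mul (mdifferentiableAt_mvfderiv_coordField hf 1))

lemma oneFormDeriv_mvfderiv (hX : VField.DiffAt X p) (hY : VField.DiffAt Y p) :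
    oneFormDeriv (𝓡 2) (mvfderiv (𝓡 2) f) X Y p = 0 := by
  rw [oneFormDeriv_eq_det_mul (oneFormDiffAt_mvfderiv hf) (diffAt_coordField p 0)
    (diffAt_coordField p 1) hX hY (apply_eq_coordL_smul_add p X) (apply_eq_coordL_smul_add p Y),
    oneFormDeriv, mlieBracket_coordField, map_zero, mvfderiv_mvfderiv_coordField_comm hf 1 0,
    sub_self, sub_zero, mul_zero]

end SecondOrder

/-! ### The Levi-Civita connection -/

section Connection

variable (g : Metric M)

lemma coordComp_add_eventuallyEq (p : M) (Y Z : VField M) (i : Fin 2) :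
    coordComp p (Y + Z) i =ᶠ[𝓝 p] coordComp p Y i + coordComp p Z i := by
  filter_upwards [eventually_mem_chart_source p] with q hq
  exact congrArg (fun v : Plane ↦ v i) <|
    ((trivializationAt Plane (TangentSpace (𝓡 2)) p).linear ℝ
      (mem_baseSet_trivializationAt hq)).map_add (Y q) (Z q)

lemma coordComp_smul_eventuallyEq (p : M) (f : M → ℝ) (Y : VField M) (i : Fin 2) :
    coordComp p (f • Y) i =ᶠ[𝓝 p] f * coordComp p Y i := by
  filter_upwards [eventually_mem_chart_source p] with q hq
  exact congrArg (fun v : Plane ↦ v i) <|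
    ((trivializationAt Plane (TangentSpace (𝓡 2)) p).linear ℝ
      (mem_baseSet_trivializationAt hq)).map_smul (f q) (Y q)

lemma nabla_apply (Y : VField M) (p : M) (v : TangentSpace (𝓡 2) p) :
    nabla g Y p v = ∑ k, (mvfderiv (𝓡 2) (coordComp p Y k) p v +
      ∑ i, ∑ j, christoffel g p k i j * coordComp p Y j p * coordL p i v) • coordField p k p := by
  simp [nabla]

lemma nabla_congr (h : Y =ᶠ[𝓝 p] Z) : nabla g Y p = nabla g Z p := by
  have h_comp (k : Fin 2) : coordComp p Y k =ᶠ[𝓝 p] coordComp p Z k :=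
    h.mono fun q hq ↦ by simp only [coordComp, hq]
  simp only [nabla, mvfderiv_congr (h_comp _), (h_comp _).self_of_nhds]

lemma isCovariantDerivativeOn_nabla : IsCovariantDerivativeOn Plane (nabla g) univ where
  add {Y Z p} hY hZ _ := by
    ext v
    simp only [nabla_apply, mvfderiv_congr (coordComp_add_eventuallyEq p Y Z _),
      (coordComp_add_eventuallyEq p Y Z _).self_of_nhds, add_apply, ← Finset.sum_add_distrib]
    refine Finset.sum_congr rfl fun k _ ↦ ?_
    rw [mvfderiv_add (mdifferentiableAt_coordComp hY k) (mdifferentiableAt_coordComp hZ k),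
      ← add_smul]
    simp only [add_apply, Pi.add_apply, Fin.sum_univ_two]
    congr 1
    ring
  leibniz {Y f p} hY hf _ := by
    ext v
    simp only [nabla_apply, mvfderiv_congr (coordComp_smul_eventuallyEq p f Y _),
      (coordComp_smul_eventuallyEq p f Y _).self_of_nhds, add_apply, smul_apply,
      ContinuousLinearMap.smulRight_apply]
    rw [← sum_coordComp (mem_chart_source Plane p) Y, Finset.smul_sum, Finset.smul_sum,
      ← Finset.sum_add_distrib]
    refine Finset.sum_congr rfl fun k _ ↦ ?_
    rw [mvfderiv_mul hf (mdifferentiableAt_coordComp hY k), smul_smul, smul_smul, ← add_smul]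
    simp only [add_apply, smul_apply, smul_eq_mul, Pi.mul_apply, Fin.sum_univ_two]
    congr 1
    ring

lemma nabla_coordField (p : M) (i j : Fin 2) :
    nabla g (coordField p j) p (coordField p i p) =
      ∑ k, christoffel g p k i j • coordField p k p := by
  have h_comp (k : Fin 2) : coordComp p (coordField p j) k =ᶠ[𝓝 p] fun _ ↦ if k = j then 1 else 0 :=
    (eventually_mem_chart_source p).mono fun q hq ↦ by
      simp [coordComp, trivializationAt_coordField hq]
  simp only [nabla_apply, mvfderiv_congr (h_comp _), (h_comp _).self_of_nhds, mvfderiv_const,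
    coordL_coordField]
  simp

lemma gram_symm (p q : M) (i j : Fin 2) : gram g p q i j = gram g p q j i :=
  g.symm _ _ _

lemma dGram_symm (p : M) (k i j : Fin 2) : dGram g p k i j = dGram g p k j i := by
  simp only [dGram, gram_symm g p _ i j]

lemma christoffel_symm (p : M) (k i j : Fin 2) :
    christoffel g p k i j = christoffel g p k j i := by
  simp only [christoffel, dGram_symm g p _ i j, add_comm (dGram g p i j _)]

lemma nabla_sub_nabla (hX : VField.DiffAt X p) (hY : VField.DiffAt Y p) :
    nabla g Y p (X p) - nabla g X p (Y p) = VectorField.mlieBracket (𝓡 2) X Y p := by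
  set τ := (isCovariantDerivativeOn_nabla g).torsion p
  have h_coord (i j : Fin 2) : τ (coordField p i p) (coordField p j p) = 0 := by
    rw [IsCovariantDerivativeOn.torsion_apply _ (diffAt_coordField p i) (diffAt_coordField p j),
      nabla_coordField, nabla_coordField, mlieBracket_coordField]
    simp only [christoffel_symm g p _ i j, sub_self]
  have h_zero : τ (X p) (Y p) = 0 := by
    rw [apply_eq_coordL_smul_add p X, apply_eq_coordL_smul_add p Y]
    simp [h_coord]
  rwa [IsCovariantDerivativeOn.torsion_apply _ hX hY, sub_eq_zero] at h_zero

lemma det_gram_ne_zero (p : M) : (Matrix.of (gram g p p)).det ≠ 0 := by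
  intro h
  obtain ⟨c, hc, hc0⟩ := Matrix.exists_mulVec_eq_zero_iff.2 h
  set w := ∑ i, c i • coordField p i p
  have hw : w ≠ 0 := fun h0 ↦ hc <| funext fun i ↦ by
    simpa only [w, map_sum, map_smul, coordL_coordField, map_zero, smul_eq_mul, mul_ite, mul_one,
      mul_zero, Finset.sum_ite_eq, Finset.mem_univ, if_true, Pi.zero_apply] using
      congrArg (coordL p i) h0
  have h_inner : g.inner p w w = ∑ i, c i * (Matrix.of (gram g p p)).mulVec c i := by
    simp only [w, Matrix.mulVec, dotProduct, gram, Fin.sum_univ_two, map_add, map_smul, add_apply,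
      smul_apply, smul_eq_mul, Matrix.of_apply]
    ring
  refine (g.pos p w hw).ne' ?_
  simp [h_inner, hc0]

lemma sum_christoffel_mul_gram (p : M) (i j l : Fin 2) :
    ∑ k, christoffel g p k i j * gram g p p k l =
      (1 / 2) * (dGram g p i j l + dGram g p j i l - dGram g p l i j) := by
  set G := Matrix.of (gram g p p) with hG
  set D : Fin 2 → ℝ := fun m ↦ dGram g p i j m + dGram g p j i m - dGram g p m i j
  have h_christoffel (k : Fin 2) : christoffel g p k i j = (1 / 2) * (G⁻¹.mulVec D) k := rfl
  have h_mulVec : G.mulVec (G⁻¹.mulVec D) = D := by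
    rw [Matrix.mulVec_mulVec,
      Matrix.mul_nonsing_inv _ (isUnit_iff_ne_zero.2 (det_gram_ne_zero g p)), Matrix.one_mulVec]
  calc ∑ k, christoffel g p k i j * gram g p p k l
      = (1 / 2) * ∑ k, G l k * (G⁻¹.mulVec D) k := by
        rw [Finset.mul_sum]
        refine Finset.sum_congr rfl fun k _ ↦ ?_
        rw [h_christoffel, hG, Matrix.of_apply, gram_symm g p p l k]
        ring
    _ = (1 / 2) * D l := congrArg (fun w : Fin 2 → ℝ ↦ 1 / 2 * w l) h_mulVec

lemma dGram_eq_sum_christoffel (p : M) (a i j : Fin 2) :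
    dGram g p a i j =
      ∑ k, (christoffel g p k a i * gram g p p k j + christoffel g p k a j * gram g p p k i) := by
  rw [Finset.sum_add_distrib, sum_christoffel_mul_gram, sum_christoffel_mul_gram,
    dGram_symm g p a j i, dGram_symm g p i a j, dGram_symm g p j a i]
  ring

/-- The nonmetricity `(∇_v g)(Y, Z) = v(g(Y, Z)) - g(∇_v Y, Z) - g(Y, ∇_v Z)` of the connection
`nabla g`, as a one-form in `v`; its vanishing is the compatibility of `nabla g` with `g`. -/
def nonmetricity (Y Z : VField M) (p : M) : TangentSpace (𝓡 2) p →L[ℝ] ℝ :=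
  mvfderiv (𝓡 2) (fun q ↦ g.inner q (Y q) (Z q)) p - (g.inner p (Z p)).comp (nabla g Y p) -
    (g.inner p (Y p)).comp (nabla g Z p)

lemma nonmetricity_symm (Y Z : VField M) (p : M) :
    nonmetricity g Y Z p = nonmetricity g Z Y p := by
  simp only [nonmetricity, g.symm _ (Y _) (Z _)]
  abel

lemma tensorialAt_nonmetricity (hY : VField.DiffAt Y p) :
    TensorialAt (𝓡 2) Plane (nonmetricity g Y · p) p where
  smul {f Z} hf hZ := by
    have h : mvfderiv (𝓡 2) (fun q ↦ g.inner q (Y q) ((f • Z) q)) p =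
        f p • mvfderiv (𝓡 2) (fun q ↦ g.inner q (Y q) (Z q)) p +
          g.inner p (Y p) (Z p) • mvfderiv (𝓡 2) f p := by
      rw [← mvfderiv_mul hf (mdifferentiableAt_inner g hY hZ)]
      congr 1 with q
      simp
    ext v
    rw [nonmetricity, h, (isCovariantDerivativeOn_nabla g).leibniz hZ hf]
    simp only [nonmetricity, sub_apply, add_apply, smul_apply, ContinuousLinearMap.comp_apply,
      Pi.smul_apply', map_smul, map_add, ContinuousLinearMap.smulRight_apply, smul_eq_mul]
    ring
  add {Z W} hZ hW := by
    have h : mvfderiv (𝓡 2) (fun q ↦ g.inner q (Y q) ((Z + W) q)) p =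
        mvfderiv (𝓡 2) (fun q ↦ g.inner q (Y q) (Z q)) p +
          mvfderiv (𝓡 2) (fun q ↦ g.inner q (Y q) (W q)) p := by
      rw [← mvfderiv_add (mdifferentiableAt_inner g hY hZ) (mdifferentiableAt_inner g hY hW)]
      congr 1 with q
      simp
    ext v
    rw [nonmetricity, h, (isCovariantDerivativeOn_nabla g).add hZ hW]
    simp only [nonmetricity, sub_apply, add_apply, ContinuousLinearMap.comp_apply, Pi.add_apply,
      map_add]
    ring

lemma eq_zero_of_tensorialAt {A : Type*} [AddCommGroup A] [Module ℝ A] [TopologicalSpace A]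
    [IsTopologicalAddGroup A] [ContinuousSMul ℝ A] {Φ : VField M → A}
    (hΦ : TensorialAt (𝓡 2) Plane Φ p)
    (h_coord : ∀ i, Φ (coordField p i) = 0) (hY : VField.DiffAt Y p) : Φ Y = 0 := by
  rw [← TensorialAt.mkHom_apply hΦ hY, apply_eq_coordL_smul_add p Y, map_add, map_smul, map_smul,
    TensorialAt.mkHom_apply hΦ (diffAt_coordField p 0),
    TensorialAt.mkHom_apply hΦ (diffAt_coordField p 1), h_coord, h_coord, smul_zero, smul_zero,
    add_zero]

lemma nonmetricity_coordField (p : M) (i j : Fin 2) :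
    nonmetricity g (coordField p i) (coordField p j) p = 0 := by
  have h_coord (a : Fin 2) :
      nonmetricity g (coordField p i) (coordField p j) p (coordField p a p) = 0 := by
    have h := dGram_eq_sum_christoffel g p a i j
    simp only [dGram, gram, Fin.sum_univ_two, g.symm p (coordField p _ p) (coordField p j p),
      g.symm p (coordField p _ p) (coordField p i p)] at h
    simp only [nonmetricity, sub_apply, ContinuousLinearMap.comp_apply, nabla_coordField,
      Fin.sum_univ_two, map_add, map_smul, smul_eq_mul, h]
    ring
  ext v
  rw [apply_eq_coordL_smul_add p fun _ ↦ v]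
  simp [h_coord]

lemma nonmetricity_eq_zero (hY : VField.DiffAt Y p) (hZ : VField.DiffAt Z p) :
    nonmetricity g Y Z p = 0 := by
  refine eq_zero_of_tensorialAt (tensorialAt_nonmetricity g hY) (fun j ↦ ?_) hZ
  rw [nonmetricity_symm]
  exact eq_zero_of_tensorialAt (tensorialAt_nonmetricity g (diffAt_coordField p j))
    (fun i ↦ nonmetricity_coordField g p j i) hY

lemma mvfderiv_inner (hY : VField.DiffAt Y p) (hZ : VField.DiffAt Z p) (v : TangentSpace (𝓡 2) p) :
    mvfderiv (𝓡 2) (fun q ↦ g.inner q (Y q) (Z q)) p v =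
      g.inner p (nabla g Y p v) (Z p) + g.inner p (Y p) (nabla g Z p v) := by
  have h : nonmetricity g Y Z p v = 0 := by rw [nonmetricity_eq_zero g hY hZ, zero_apply]
  rw [g.symm p (nabla g Y p v)]
  simp only [nonmetricity, sub_apply, ContinuousLinearMap.comp_apply] at h
  linarith

end Connection

/-! ### Orthonormal frames and their connection form -/

/-- The tangent vectors `u`, `v` at `p` form a `g`-orthonormal basis. -/
structure IsOrthonormal (g : Metric M) (p : M) (u v : TangentSpace (𝓡 2) p) : Prop where
  fst : g.inner p u u = 1
  snd : g.inner p v v = 1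
  orth : g.inner p u v = 0

namespace IsOrthonormal

variable {g : Metric M} {u v : TangentSpace (𝓡 2) p}

lemma orth' (h : IsOrthonormal g p u v) : g.inner p v u = 0 := by
  rw [g.symm, h.orth]

lemma expand (h : IsOrthonormal g p u v) (w : TangentSpace (𝓡 2) p) :
    g.inner p u w • u + g.inner p v w • v = w := by
  have h_indep : LinearIndependent ℝ ![u, v] := by
    rw [LinearIndependent.pair_iff]
    intro a b hab
    have ha := congrArg (g.inner p u) hab
    have hb := congrArg (g.inner p v) hab
    simp only [map_add, map_smul, h.fst, h.snd, h.orth, h.orth', smul_eq_mul, mul_one, mul_zero,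
      add_zero, zero_add, map_zero] at ha hb
    exact ⟨ha, hb⟩
  have hw : w ∈ Submodule.span ℝ (Set.range ![u, v]) := by
    rw [h_indep.span_eq_top_of_card_eq_finrank' (by simp [finrank_tangentSpace])]
    exact Submodule.mem_top
  rw [Matrix.range_cons, Matrix.range_cons, Matrix.range_empty, Set.union_empty,
    Set.singleton_union, Submodule.mem_span_pair] at hw
  obtain ⟨a, b, rfl⟩ := hw
  simp [h.fst, h.snd, h.orth, h.orth']

lemma ext_inner (h : IsOrthonormal g p u v) {w w' : TangentSpace (𝓡 2) p}
    (hu : g.inner p u w = g.inner p u w') (hv : g.inner p v w = g.inner p v w') : w = w' := by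
  rw [← h.expand w, ← h.expand w', hu, hv]

lemma inner_eq (h : IsOrthonormal g p u v) (w w' : TangentSpace (𝓡 2) p) :
    g.inner p w w' = g.inner p u w * g.inner p u w' + g.inner p v w * g.inner p v w' := by
  conv_lhs => rw [← h.expand w']
  rw [map_add, map_smul, map_smul, g.symm p w u, g.symm p w v, smul_eq_mul, smul_eq_mul]
  ring

lemma trace_eq (h : IsOrthonormal g p u v)
    (A : TangentSpace (𝓡 2) p →L[ℝ] TangentSpace (𝓡 2) p) :
    LinearMap.trace ℝ (TangentSpace (𝓡 2) p) A.toLinearMap =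
      g.inner p u (A u) + g.inner p v (A v) := by
  have hA : A.toLinearMap = (g.inner p u).toLinearMap.smulRight (A u) +
      (g.inner p v).toLinearMap.smulRight (A v) := by
    ext w
    conv_lhs => rw [← h.expand w]
    simp
  rw [hA, map_add, LinearMap.trace_smulRight, LinearMap.trace_smulRight]
  rfl

lemma det_gram (h : IsOrthonormal g p u v) :
    (Matrix.of (gram g p p)).det =
      (g.inner p u (coordField p 0 p) * g.inner p v (coordField p 1 p) -
        g.inner p v (coordField p 0 p) * g.inner p u (coordField p 1 p)) ^ 2 := by
  simp only [Matrix.det_fin_two, Matrix.of_apply, gram, h.inner_eq (coordField p _ p)]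
  ring

end IsOrthonormal

lemma inner_nabla_add_inner_nabla_eq_zero {g : Metric M} {c : ℝ} (hY : VField.DiffAt Y p)
    (hZ : VField.DiffAt Z p) (h : (fun q ↦ g.inner q (Y q) (Z q)) =ᶠ[𝓝 p] fun _ ↦ c)
    (v : TangentSpace (𝓡 2) p) :
    g.inner p (Z p) (nabla g Y p v) + g.inner p (Y p) (nabla g Z p v) = 0 := by
  rw [← g.symm p (nabla g Y p v), ← mvfderiv_inner g hY hZ, mvfderiv_congr h, mvfderiv_const,
    zero_apply]

/-- `T`, `N` is a `g`-orthonormal frame of class `C²` near `p`. -/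
structure IsFrameAt (g : Metric M) (T N : VField M) (p : M) : Prop where
  contT : VField.ContAt 2 T p
  contN : VField.ContAt 2 N p
  eventually_orthonormal : ∀ᶠ q in 𝓝 p, IsOrthonormal g q (T q) (N q)

/-- The connection form `v ↦ g(∇_v T, N)` of an orthonormal frame `T`, `N`. -/
def connForm (g : Metric M) (T N : VField M) (q : M) : TangentSpace (𝓡 2) q →L[ℝ] ℝ :=
  (g.inner q (N q)).comp (nabla g T q)

namespace IsFrameAt

variable {g : Metric M} {T N : VField M} (h : IsFrameAt g T N p)
include h

lemma eventually : ∀ᶠ q in 𝓝 p, IsFrameAt g T N q := by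
  filter_upwards [VField.ContAt.eventually (n := 2) h.contT,
    VField.ContAt.eventually (n := 2) h.contN,
    eventually_eventually_nhds.2 h.eventually_orthonormal] with q hT hN hTN
  exact ⟨hT, hN, hTN⟩

lemma diffT : VField.DiffAt T p := h.contT.mdifferentiableAt two_ne_zero

lemma diffN : VField.DiffAt N p := h.contN.mdifferentiableAt two_ne_zero

lemma orthonormal : IsOrthonormal g p (T p) (N p) :=
  h.eventually_orthonormal.self_of_nhds

lemma nabla_T (v : TangentSpace (𝓡 2) p) : nabla g T p v = connForm g T N p v • N p := by
  have h_TT := inner_nabla_add_inner_nabla_eq_zero h.diffT h.diffT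
    (h.eventually_orthonormal.mono fun q hq ↦ hq.fst) v
  rw [← h.orthonormal.expand (nabla g T p v), add_self_eq_zero.1 h_TT, zero_smul, zero_add]
  rfl

lemma nabla_N (v : TangentSpace (𝓡 2) p) : nabla g N p v = -connForm g T N p v • T p := by
  have h_NN := inner_nabla_add_inner_nabla_eq_zero h.diffN h.diffN
    (h.eventually_orthonormal.mono fun q hq ↦ hq.snd) v
  have h_TN := inner_nabla_add_inner_nabla_eq_zero h.diffT h.diffN
    (h.eventually_orthonormal.mono fun q hq ↦ hq.orth) v
  rw [← h.orthonormal.expand (nabla g N p v), add_self_eq_zero.1 h_NN, zero_smul, add_zero,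
    ← neg_eq_of_add_eq_zero_right h_TN]
  rfl

lemma connForm_T : connForm g T N p (T p) = geodCurvature g N p := by
  rw [geodCurvature, h.orthonormal.trace_eq]
  simp [weingarten, hat, h.orthonormal.snd, h.orthonormal.orth', h.nabla_N, h.orthonormal.fst]

lemma mlieBracket_eq :
    VectorField.mlieBracket (𝓡 2) T N p =
      -connForm g T N p (T p) • T p - connForm g T N p (N p) • N p := by
  rw [← nabla_sub_nabla g h.diffT h.diffN, h.nabla_N, h.nabla_T]

lemma mdifferentiableAt_connForm_T :
    MDifferentiableAt (𝓡 2) 𝓘(ℝ, ℝ) (fun q ↦ connForm g T N q (T q)) p := by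
  have h_bracket := mdifferentiableAt_inner g h.diffT
    ((h.contT.mlieBracket h.contN).mdifferentiableAt one_ne_zero)
  refine h_bracket.neg.congr_of_eventuallyEq (h.eventually.mono fun q hq ↦ ?_)
  simp [hq.mlieBracket_eq, hq.orthonormal.fst, hq.orthonormal.orth]

lemma mdifferentiableAt_connForm_N :
    MDifferentiableAt (𝓡 2) 𝓘(ℝ, ℝ) (fun q ↦ connForm g T N q (N q)) p := by
  have h_bracket := mdifferentiableAt_inner g h.diffN
    ((h.contT.mlieBracket h.contN).mdifferentiableAt one_ne_zero)
  refine h_bracket.neg.congr_of_eventuallyEq (h.eventually.mono fun q hq ↦ ?_)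
  simp [hq.mlieBracket_eq, hq.orthonormal.snd, hq.orthonormal.orth']

lemma oneFormDiffAt_connForm : OneFormDiffAt (𝓡 2) (connForm g T N) p := by
  intro Y hY
  have h_mul := ((mdifferentiableAt_inner g h.diffT hY).mul h.mdifferentiableAt_connForm_T).add
    ((mdifferentiableAt_inner g h.diffN hY).mul h.mdifferentiableAt_connForm_N)
  refine h_mul.congr_of_eventuallyEq (h.eventually_orthonormal.mono fun q hq ↦ ?_)
  change connForm g T N q (Y q) = _
  conv_lhs => rw [← hq.expand (Y q), map_add, map_smul, map_smul]
  rfl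

lemma nabla_smul_add_smul {a b : M → ℝ} (ha : MDifferentiableAt (𝓡 2) 𝓘(ℝ, ℝ) a p)
    (hb : MDifferentiableAt (𝓡 2) 𝓘(ℝ, ℝ) b p) (v : TangentSpace (𝓡 2) p) :
    nabla g (a • T + b • N) p v =
      (mvfderiv (𝓡 2) a p v - b p * connForm g T N p v) • T p +
      (mvfderiv (𝓡 2) b p v + a p * connForm g T N p v) • N p := by
  rw [(isCovariantDerivativeOn_nabla g).add (ha.smul_section h.diffT) (hb.smul_section h.diffN),
    (isCovariantDerivativeOn_nabla g).leibniz h.diffT ha,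
    (isCovariantDerivativeOn_nabla g).leibniz h.diffN hb]
  simp only [add_apply, smul_apply, ContinuousLinearMap.smulRight_apply, h.nabla_T, h.nabla_N]
  module

lemma nabla_eq (hY : VField.DiffAt Y p) (v : TangentSpace (𝓡 2) p) :
    nabla g Y p v =
      (mvfderiv (𝓡 2) (fun q ↦ g.inner q (T q) (Y q)) p v -
        g.inner p (N p) (Y p) * connForm g T N p v) • T p +
      (mvfderiv (𝓡 2) (fun q ↦ g.inner q (N q) (Y q)) p v +
        g.inner p (T p) (Y p) * connForm g T N p v) • N p := by
  have h_expand : Y =ᶠ[𝓝 p]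
      (fun q ↦ g.inner q (T q) (Y q)) • T + (fun q ↦ g.inner q (N q) (Y q)) • N :=
    h.eventually_orthonormal.mono fun q hq ↦ (hq.expand (Y q)).symm
  rw [nabla_congr g h_expand, h.nabla_smul_add_smul (mdifferentiableAt_inner g h.diffT hY)
    (mdifferentiableAt_inner g h.diffN hY)]

lemma curvature_eq_of_nabla_eq {α β : (q : M) → TangentSpace (𝓡 2) q →L[ℝ] ℝ}
    (hα : OneFormDiffAt (𝓡 2) α p) (hβ : OneFormDiffAt (𝓡 2) β p)
    (hZ : ∀ᶠ q in 𝓝 p, ∀ v, nabla g Z q v = α q v • T q + β q v • N q)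
    (hX : VField.DiffAt X p) (hY : VField.DiffAt Y p) :
    curvature g X Y Z p =
      (oneFormDeriv (𝓡 2) α X Y p -
        (connForm g T N p (X p) * β p (Y p) - connForm g T N p (Y p) * β p (X p))) • T p +
      (oneFormDeriv (𝓡 2) β X Y p +
        (connForm g T N p (X p) * α p (Y p) - connForm g T N p (Y p) * α p (X p))) • N p := by
  have h_nabla {W : VField M} (hW : VField.DiffAt W p) (v : TangentSpace (𝓡 2) p) :
      nabla g (fun q ↦ nabla g Z q (W q)) p v =
        (mvfderiv (𝓡 2) (fun q ↦ α q (W q)) p v - β p (W p) * connForm g T N p v) • T p +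
        (mvfderiv (𝓡 2) (fun q ↦ β q (W q)) p v + α p (W p) * connForm g T N p v) • N p := by
    rw [← h.nabla_smul_add_smul (hα hW) (hβ hW)]
    exact congrArg (fun L ↦ L v) (nabla_congr g (hZ.mono fun q hq ↦ hq (W q)))
  rw [curvature, h_nabla hY, h_nabla hX, hZ.self_of_nhds, oneFormDeriv, oneFormDeriv]
  module

lemma curvature_eq (hX : VField.DiffAt X p) (hY : VField.DiffAt Y p) (hZ : VField.ContAt 2 Z p) :
    curvature g X Y Z p = oneFormDeriv (𝓡 2) (connForm g T N) X Y p •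
      (g.inner p (T p) (Z p) • N p - g.inner p (N p) (Z p) • T p) := by
  set θ := connForm g T N
  set a : M → ℝ := fun q ↦ g.inner q (T q) (Z q)
  set b : M → ℝ := fun q ↦ g.inner q (N q) (Z q)
  have ha : ContMDiffAt (𝓡 2) 𝓘(ℝ, ℝ) 2 a p := contMDiffAt_inner le_rfl g h.contT hZ
  have hb : ContMDiffAt (𝓡 2) 𝓘(ℝ, ℝ) 2 b p := contMDiffAt_inner le_rfl g h.contN hZ
  have ha' := ha.mdifferentiableAt two_ne_zero
  have hb' := hb.mdifferentiableAt two_ne_zero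
  have haθ := h.oneFormDiffAt_connForm.smul ha'
  have hbθ := h.oneFormDiffAt_connForm.smul hb'
  have h_nabla : ∀ᶠ q in 𝓝 p, ∀ v, nabla g Z q v =
      (mvfderiv (𝓡 2) a - b • θ) q v • T q + (mvfderiv (𝓡 2) b + a • θ) q v • N q := by
    filter_upwards [h.eventually, VField.ContAt.eventually (n := 2) hZ] with q hq hZq v
    exact hq.nabla_eq (hZq.mdifferentiableAt two_ne_zero) v
  rw [h.curvature_eq_of_nabla_eq ((oneFormDiffAt_mvfderiv ha).sub hbθ)
      ((oneFormDiffAt_mvfderiv hb).add haθ) h_nabla hX hY,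
    oneFormDeriv_sub (oneFormDiffAt_mvfderiv ha) hbθ hX hY,
    oneFormDeriv_add (oneFormDiffAt_mvfderiv hb) haθ hX hY, oneFormDeriv_mvfderiv ha hX hY,
    oneFormDeriv_mvfderiv hb hX hY, oneFormDeriv_smul ha' h.oneFormDiffAt_connForm hX hY,
    oneFormDeriv_smul hb' h.oneFormDiffAt_connForm hX hY]
  simp only [Pi.sub_apply, Pi.add_apply, Pi.smul_apply', sub_apply, add_apply, smul_apply,
    smul_eq_mul]
  module

lemma gaussCurvature_eq_neg_oneFormDeriv :
    gaussCurvature g p = -oneFormDeriv (𝓡 2) (connForm g T N) T N p := by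
  set D := g.inner p (T p) (coordField p 0 p) * g.inner p (N p) (coordField p 1 p) -
    g.inner p (N p) (coordField p 0 p) * g.inner p (T p) (coordField p 1 p)
  have h_det : (Matrix.of (gram g p p)).det = D ^ 2 := h.orthonormal.det_gram
  have hD : D ^ 2 ≠ 0 := h_det ▸ det_gram_ne_zero g p
  have h_deriv : oneFormDeriv (𝓡 2) (connForm g T N) (coordField p 0) (coordField p 1) p =
      D * oneFormDeriv (𝓡 2) (connForm g T N) T N p :=
    oneFormDeriv_eq_det_mul h.oneFormDiffAt_connForm h.diffT h.diffN (diffAt_coordField p 0)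
      (diffAt_coordField p 1) (h.orthonormal.expand _).symm (h.orthonormal.expand _).symm
  have h_curvature : g.inner p (curvature g (coordField p 0) (coordField p 1) (coordField p 1) p)
      (coordField p 0 p) = -oneFormDeriv (𝓡 2) (connForm g T N) T N p * D ^ 2 := by
    rw [h.curvature_eq (diffAt_coordField p 0) (diffAt_coordField p 1) (contAt_coordField p 1 2),
      h_deriv]
    simp only [map_smul, map_sub, smul_apply, sub_apply, smul_eq_mul, D]
    ring
  rw [gaussCurvature, h_curvature, h_det, mul_div_cancel_right₀ _ hD]

lemma oneFormDeriv_connForm :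
    oneFormDeriv (𝓡 2) (connForm g T N) T N p =
      mvfderiv (𝓡 2) (fun q ↦ connForm g T N q (N q)) p (T p) -
        mvfderiv (𝓡 2) (geodCurvature g N) p (N p) + geodCurvature g N p ^ 2 +
        connForm g T N p (N p) ^ 2 := by
  rw [oneFormDeriv, h.mlieBracket_eq, mvfderiv_congr (h.eventually.mono fun q hq ↦ hq.connForm_T),
    map_sub, map_smul, map_smul, h.connForm_T, smul_eq_mul, smul_eq_mul]
  ring

lemma divergence_nabla_N :
    divergence g (fun q ↦ nabla g N q (N q)) p =
      -mvfderiv (𝓡 2) (fun q ↦ connForm g T N q (N q)) p (T p) - connForm g T N p (N p) ^ 2 := by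
  have h_nabla : (fun q ↦ nabla g N q (N q)) =ᶠ[𝓝 p] (-fun q ↦ connForm g T N q (N q)) • T :=
    h.eventually.mono fun q hq ↦ hq.nabla_N (N q)
  rw [divergence, nabla_congr g h_nabla, (isCovariantDerivativeOn_nabla g).leibniz h.diffT
    h.mdifferentiableAt_connForm_N.neg, h.orthonormal.trace_eq, mvfderiv_neg]
  simp only [add_apply, smul_apply, ContinuousLinearMap.smulRight_apply, h.nabla_T, map_add,
    map_smul, h.orthonormal.fst, h.orthonormal.snd, h.orthonormal.orth, h.orthonormal.orth',
    Pi.neg_apply, neg_apply, smul_eq_mul]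
  ring

lemma gaussCurvature_eq_divergence_add :
    gaussCurvature g p = divergence g (fun q ↦ nabla g N q (N q)) p +
      mvfderiv (𝓡 2) (geodCurvature g N) p (N p) - geodCurvature g N p ^ 2 := by
  rw [h.gaussCurvature_eq_neg_oneFormDeriv, h.oneFormDeriv_connForm, h.divergence_nabla_N]
  ring

end IsFrameAt

/-! ### The unit normal of a foliation -/

/-- The vector field `W` divided by its length. -/
def normalize (g : Metric M) (W : VField M) : VField M := fun q ↦
  (√(g.inner q (W q) (W q)))⁻¹ • W q

section Normalize

variable {g : Metric M} {T W : VField M}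

lemma inner_normalize_left (v : TangentSpace (𝓡 2) p) :
    g.inner p (normalize g W p) v = (√(g.inner p (W p) (W p)))⁻¹ * g.inner p (W p) v := by
  rw [normalize, map_smul, smul_apply, smul_eq_mul]

lemma inner_normalize_self (hW : W p ≠ 0) :
    g.inner p (normalize g W p) (normalize g W p) = 1 := by
  have h_pos := g.pos p _ hW
  rw [inner_normalize_left, g.symm p (W p) (normalize g W p), inner_normalize_left, ← mul_assoc,
    ← mul_inv, Real.mul_self_sqrt h_pos.le, inv_mul_cancel₀ h_pos.ne']

lemma VField.ContAt.normalize (hW : VField.ContAt 2 W p) (hWp : W p ≠ 0) :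
    VField.ContAt 2 (normalize g W) p := by
  have h_pos := g.pos p _ hWp
  have h_inv_sqrt : ContDiffAt ℝ 2 (fun x : ℝ ↦ (√x)⁻¹) (g.inner p (W p) (W p)) :=
    (Real.contDiffAt_sqrt h_pos.ne').inv (Real.sqrt_ne_zero'.2 h_pos)
  have h_smul : ContMDiffAt (𝓡 2) 𝓘(ℝ, ℝ) 2 (fun q ↦ (√(g.inner q (W q) (W q)))⁻¹) p :=
    h_inv_sqrt.comp_contMDiffAt (f := fun q ↦ g.inner q (W q) (W q))
      (contMDiffAt_inner le_rfl g hW hW)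
  exact h_smul.smul_section hW

lemma VField.ContAt.eventually_ne_zero (g : Metric M) (hW : VField.ContAt 2 W p)
    (hWp : W p ≠ 0) : ∀ᶠ q in 𝓝 p, W q ≠ 0 := by
  have h_pos := (contMDiffAt_inner le_rfl g hW hW).continuousAt.eventually
    (lt_mem_nhds (g.pos p _ hWp))
  filter_upwards [h_pos] with q hq hWq
  simp [hWq] at hq

lemma IsOrthonormal.exists_isFrameAt {n : TangentSpace (𝓡 2) p} (hn : IsOrthonormal g p (T p) n)
    (hT : VField.ContAt 2 T p) (hT_unit : ∀ᶠ q in 𝓝 p, g.inner q (T q) (T q) = 1) :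
    ∃ N : VField M, IsFrameAt g T N p ∧ N p = n := by
  let V : VField M := FiberBundle.extend Plane n
  have hV : VField.ContAt 2 V p := FiberBundle.contMDiffAt_extend (𝓡 2) Plane n
  have hVp : V p = n := FiberBundle.extend_apply_self Plane n
  let W : VField M := V - (fun q ↦ g.inner q (T q) (V q)) • T
  have hW : VField.ContAt 2 W p :=
    hV.sub_section (ContMDiffAt.smul_section (contMDiffAt_inner le_rfl g hT hV) hT)
  have hWp : W p = n := by
    change V p - g.inner p (T p) (V p) • T p = n
    rw [hVp, hn.orth, zero_smul, sub_zero]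
  have hWp_ne : W p ≠ 0 := fun h ↦ by simpa [← hWp, h] using hn.snd
  refine ⟨normalize g W, ⟨hT, hW.normalize hWp_ne, ?_⟩, by simp [normalize, hWp, hn.snd]⟩
  filter_upwards [hT_unit, hW.eventually_ne_zero g hWp_ne] with q hTq hWq
  have h_orth : g.inner q (T q) (W q) = 0 := by
    change g.inner q (T q) (V q - g.inner q (T q) (V q) • T q) = 0
    rw [map_sub, map_smul, hTq, smul_eq_mul, mul_one, sub_self]
  exact ⟨hTq, inner_normalize_self hWq, by
    rw [g.symm q (T q), inner_normalize_left, g.symm q (W q) (T q), h_orth, mul_zero]⟩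

end Normalize

section Foliation

variable {r : WithTop ℕ∞} {ℱ : Foliation M r}

omit [IsManifold (𝓡 2) ∞ M] in
lemma Foliation.mk_mfderiv_symm_mem_tangent (ℱ : Foliation M r) {φ : OpenPartialHomeomorph M Plane}
    (hφ : φ ∈ IsManifold.maximalAtlas (𝓡 2) 1 M) (h_fol : IsFoliatedChart ℱ.leaves φ) {y : Plane}
    (hy : y ∈ φ.target) :
    (⟨φ.symm y, mfderiv (𝓡 2) (𝓡 2) φ.symm y (EuclideanSpace.single 0 (1 : ℝ) : Plane)⟩ :
      TangentBundle (𝓡 2) M) ∈ ℱ.tangent := by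
  set e : Plane := EuclideanSpace.single 0 1 with he
  obtain ⟨L, hL, hyL⟩ : φ.symm y ∈ ⋃₀ ℱ.leaves := by
    rw [ℱ.iUnion_leaves]
    trivial
  let c : ℝ → Plane := fun s ↦ y + s • e
  have hc_zero : c 0 = y := by simp [c]
  have hc_deriv : HasDerivAt c e 0 :=
    (((hasDerivAt_id (0 : ℝ)).smul_const e).const_add y).congr_deriv (one_smul ℝ e)
  have hc : ContDiff ℝ 1 c := by fun_prop
  have hc_target : ∀ᶠ s in 𝓝 (0 : ℝ), c s ∈ φ.target :=
    hc.continuous.continuousAt.eventually_mem (φ.open_target.mem_nhds (hc_zero.symm ▸ hy))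
  have hφ_symm : ContMDiffAt (𝓡 2) (𝓡 2) 1 φ.symm (c 0) :=
    (contMDiffOn_symm_of_mem_maximalAtlas hφ).contMDiffAt
      (φ.open_target.mem_nhds hc_target.self_of_nhds)
  refine ⟨L, hL, φ.symm ∘ c, hφ_symm.comp 0 hc.contMDiff.contMDiffAt, ?_, ?_⟩
  · filter_upwards [hc_target] with s hs
    have h_slice : c s ∈ {z ∈ φ.target | z 1 = φ (φ.symm y) 1} :=
      ⟨hs, by simp [c, he, φ.right_inv hy]⟩
    rw [← h_fol L hL _ ⟨φ.map_target hy, hyL⟩] at h_slice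
    obtain ⟨x, ⟨hx, hxL⟩, hxs⟩ := connectedComponentIn_subset _ _ h_slice
    rwa [Function.comp_apply, ← hxs, φ.left_inv hx]
  · have h_velocity : mfderiv 𝓘(ℝ, ℝ) (𝓡 2) c 0 (1 : ℝ) = e := by
      rw [mfderiv_eq_fderiv]
      exact hc_deriv.deriv
    have h_deriv : mfderiv 𝓘(ℝ, ℝ) (𝓡 2) (φ.symm ∘ c) 0 (1 : ℝ) =
        mfderiv (𝓡 2) (𝓡 2) φ.symm (c 0) e :=
      (mfderiv_comp_apply 0 (hφ_symm.mdifferentiableAt one_ne_zero)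
        (hc.contMDiff.contMDiffAt.mdifferentiableAt one_ne_zero) (1 : ℝ)).trans <|
        congrArg (mfderiv (𝓡 2) (𝓡 2) φ.symm (c 0)) h_velocity
    rw [h_deriv]
    exact congrArg (fun z ↦
      (⟨φ.symm z, mfderiv (𝓡 2) (𝓡 2) φ.symm z e⟩ : TangentBundle (𝓡 2) M)) hc_zero.symm

lemma Foliation.exists_contAt_tangent (hr : 3 ≤ r) (ℱ : Foliation M r) (p : M) :
    ∃ U : VField M, VField.ContAt 2 U p ∧
      ∀ᶠ q in 𝓝 p, U q ≠ 0 ∧ (⟨q, U q⟩ : TangentBundle (𝓡 2) M) ∈ ℱ.tangent := by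
  obtain ⟨φ, hφr, hp, -, h_fol⟩ := ℱ.exists_chart p
  have hφ : φ ∈ IsManifold.maximalAtlas (𝓡 2) 3 M := IsManifold.maximalAtlas_subset_of_le hr hφr
  have hφ_smooth := contMDiffOn_of_mem_maximalAtlas hφ
  have hφ_diff : φ.MDifferentiable (𝓡 2) (𝓡 2) := ⟨hφ_smooth.mdifferentiableOn (by simp),
    (contMDiffOn_symm_of_mem_maximalAtlas hφ).mdifferentiableOn (by simp)⟩
  set e : Plane := EuclideanSpace.single 0 1
  have h_pullback {q : M} (hq : q ∈ φ.source) :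
      VectorField.mpullback (𝓡 2) (𝓡 2) φ (constField e) q = (hφ_diff.mfderiv hq).symm e := by
    rw [VectorField.mpullback_apply]
    exact congrArg (fun L ↦ L e) (ContinuousLinearMap.inverse_equiv (hφ_diff.mfderiv hq))
  refine ⟨VectorField.mpullback (𝓡 2) (𝓡 2) φ (constField e),
    (contMDiffAt_constField e (φ p) 2).mpullback_vectorField_preimage (n := 3)
      (hφ_smooth.contMDiffAt (φ.open_source.mem_nhds hp)) ⟨hφ_diff.mfderiv hp, rfl⟩
      (by norm_num), ?_⟩
  filter_upwards [φ.open_source.mem_nhds hp] with q hq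
  rw [h_pullback hq]
  constructor
  · have he : e ≠ 0 := (PiLp.single_eq_zero_iff 2 0).not.2 one_ne_zero
    exact fun h ↦ he ((map_eq_zero_iff _ (hφ_diff.mfderiv hq).symm.injective).1 h)
  · have h_mem := ℱ.mk_mfderiv_symm_mem_tangent
      (IsManifold.maximalAtlas_subset_of_le (by norm_num) hφ) h_fol (φ.map_source hq)
    rwa [φ.left_inv hq] at h_mem

variable {o : TransverseOrientation ℱ}

lemma TransverseOrientation.continuousAt_inner_field (o : TransverseOrientation ℱ) (g : Metric M)
    (hX : VField.ContAt 2 X p) : ContinuousAt (fun q ↦ g.inner q (X q) (o.field q)) p :=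
  (contMDiffAt_inner (n := 0) zero_le_two g (hX.of_le zero_le_two)
    (contMDiff_zero_iff.2 o.continuous_field p)).continuousAt

namespace IsUnitNormal

variable {g : Metric M} {N U : VField M} (hN : IsUnitNormal o g N)
include hN

lemma isOrthonormal_normalize (hU : U q ≠ 0)
    (hUt : (⟨q, U q⟩ : TangentBundle (𝓡 2) M) ∈ ℱ.tangent) :
    IsOrthonormal g q (normalize g U q) (N q) := by
  have h_orth : g.inner q (N q) (U q) = 0 := hN.normal _ hUt
  exact ⟨inner_normalize_self hU, hN.unit q, by
    rw [inner_normalize_left, g.symm q (U q) (N q), h_orth, mul_zero]⟩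

lemma eq_of_isOrthonormal {t n : TangentSpace (𝓡 2) q} (htN : IsOrthonormal g q t (N q))
    (htn : IsOrthonormal g q t n) (hn : 0 < g.inner q n (o.field q)) : n = N q := by
  have h_smul : g.inner q (N q) n • N q = n := by
    simpa only [htn.orth, zero_smul, zero_add] using htN.expand n
  set a := g.inner q (N q) n
  have ha_sq : a * a = 1 := by simpa [← h_smul, hN.unit q] using htn.snd
  have ha_pos : 0 < a * g.inner q (N q) (o.field q) := by simpa [← h_smul] using hn
  have ha : a = 1 := by nlinarith [pos_of_mul_pos_left ha_pos (hN.positive q).le]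
  rw [← h_smul, ha, one_smul]

lemma exists_isFrameAt (hr : 3 ≤ r) (p : M) : ∃ T, IsFrameAt g T N p := by
  obtain ⟨U, hU, hUt⟩ := ℱ.exists_contAt_tangent hr p
  have hTN : ∀ᶠ q in 𝓝 p, IsOrthonormal g q (normalize g U q) (N q) :=
    hUt.mono fun q hq ↦ hN.isOrthonormal_normalize hq.1 hq.2
  obtain ⟨N', h_frame, hN'⟩ := hTN.self_of_nhds.exists_isFrameAt
    (hU.normalize hUt.self_of_nhds.1) (hTN.mono fun q hq ↦ hq.fst)
  have h_pos : ∀ᶠ q in 𝓝 p, 0 < g.inner q (N' q) (o.field q) :=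
    (o.continuousAt_inner_field g h_frame.contN).eventually
      (lt_mem_nhds (by simpa only [hN'] using hN.positive p))
  have h_eq : ∀ᶠ q in 𝓝 p, N' q = N q := by
    filter_upwards [hTN, h_frame.eventually_orthonormal, h_pos] with q hq hq' hq_pos
    exact hN.eq_of_isOrthonormal hq hq' hq_pos
  exact ⟨_, h_frame.contT, h_frame.contN.congr_of_eventuallyEq
    (h_eq.mono fun q hq ↦ congrArg (TotalSpace.mk q) hq.symm), hTN⟩

lemma diffAt (hr : 3 ≤ r) (p : M) : VField.DiffAt N p :=
  (hN.exists_isFrameAt hr p).elim fun _ h ↦ h.diffN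

lemma inner_nabla_self (hr : 3 ≤ r) (v : TangentSpace (𝓡 2) p) :
    g.inner p (N p) (nabla g N p v) = 0 :=
  add_self_eq_zero.1 <| inner_nabla_add_inner_nabla_eq_zero (hN.diffAt hr p) (hN.diffAt hr p)
    (Eventually.of_forall hN.unit) v

lemma inner_nabla_tangent (hr : 3 ≤ r) (hU : VField.DiffAt U p)
    (hUt : ∀ᶠ q in 𝓝 p, (⟨q, U q⟩ : TangentBundle (𝓡 2) M) ∈ ℱ.tangent) :
    g.inner p (U p) (nabla g N p (N p)) =
      -g.inner p (N p) (VectorField.mlieBracket (𝓡 2) N U p) := by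
  have h_zero := inner_nabla_add_inner_nabla_eq_zero (hN.diffAt hr p) hU
    (hUt.mono fun q hq ↦ hN.normal _ hq) (N p)
  rw [← nabla_sub_nabla g (hN.diffAt hr p) hU, map_sub, hN.inner_nabla_self hr, sub_zero]
  exact eq_neg_of_add_eq_zero_left h_zero

end IsUnitNormal

section Flow

/-! ### Extrinsic geometric flows -/

lemma IsUnitNormal.inner_hat_hat {g : Metric M} {N : VField M} (hN : IsUnitNormal o g N)
    {u : TangentSpace (𝓡 2) q} (hu : (⟨q, u⟩ : TangentBundle (𝓡 2) M) ∈ ℱ.tangent)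
    (v : TangentSpace (𝓡 2) q) : g.inner q (hat g N q u) (hat g N q v) = g.inner q u v := by
  have h_normal : g.inner q (N q) u = 0 := hN.normal _ hu
  simp [hat, h_normal, g.symm q u (N q)]

lemma IsOrthonormal.hat_eq {g : Metric M} {N : VField M} {u : TangentSpace (𝓡 2) q}
    (h : IsOrthonormal g q u (N q)) (v : TangentSpace (𝓡 2) q) :
    hat g N q v = g.inner q u v • u := by
  rw [eq_comm, ← sub_eq_zero]
  simpa [hat, sub_sub_eq_add_sub, sub_eq_zero] using h.expand v

/-- The metrics `g t`, `t ∈ [0, ε)`, with positive unit normals `N t`, evolve by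
`∂ₜ g_t = P_t ĝ_t` at an arbitrary speed `P` that is continuous in time. The flows of `IsEGF` are
those with `P = ψ(λ_t, t)`. -/
structure IsLeafwiseConformalFlow (o : TransverseOrientation ℱ) (P : ℝ → M → ℝ) (ε : ℝ)
    (g : ℝ → Metric M) (N : ℝ → VField M) : Prop where
  continuousOn_speed : ∀ q, ContinuousOn (fun s ↦ P s q) (Ico 0 ε)
  isUnitNormal : ∀ t ∈ Ico 0 ε, IsUnitNormal o (g t) (N t)
  hasDerivWithinAt : ∀ t ∈ Ico 0 ε, ∀ (q : M) (u v : TangentSpace (𝓡 2) q),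
    HasDerivWithinAt (fun s ↦ (g s).inner q u v)
      (P t q * (g t).inner q (hat (g t) (N t) q u) (hat (g t) (N t) q v)) (Ico 0 ε) t

variable {ε t : ℝ} {g : ℝ → Metric M} {N : ℝ → VField M}

namespace IsLeafwiseConformalFlow

variable {P : ℝ → M → ℝ} (hg : IsLeafwiseConformalFlow o P ε g N) (ht : t ∈ Ico 0 ε)
include hg ht

lemma isUnitNormal_zero : IsUnitNormal o (g 0) (N 0) :=
  hg.isUnitNormal 0 ⟨le_rfl, ht.1.trans_lt ht.2⟩

lemma inner_tangent_eq {u : TangentSpace (𝓡 2) q}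
    (hu : (⟨q, u⟩ : TangentBundle (𝓡 2) M) ∈ ℱ.tangent) (v : TangentSpace (𝓡 2) q) :
    (g t).inner q u v = Real.exp (∫ s in (0 : ℝ)..t, P s q) * (g 0).inner q u v := by
  have h_sub : Icc 0 t ⊆ Ico 0 ε := Icc_subset_Ico_right ht.2
  refine eq_exp_integral_smul (f := fun s ↦ (g s).inner q u v) ht.1
    ((hg.continuousOn_speed q).mono h_sub) fun s hs ↦ ?_
  simpa only [(hg.isUnitNormal s (h_sub hs)).inner_hat_hat hu, smul_eq_mul] using
    (hg.hasDerivWithinAt s (h_sub hs) q u v).mono h_sub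

lemma inner_tangent_normal_zero {u : TangentSpace (𝓡 2) q}
    (hu : (⟨q, u⟩ : TangentBundle (𝓡 2) M) ∈ ℱ.tangent) : (g t).inner q u (N 0 q) = 0 := by
  rw [hg.inner_tangent_eq ht hu, (g 0).symm, (hg.isUnitNormal_zero ht).normal _ hu, mul_zero]

variable (hr : 3 ≤ r)
include hr

lemma hat_normal_zero (q : M) : hat (g t) (N t) q (N 0 q) = 0 := by
  obtain ⟨U, -, hU⟩ := ℱ.exists_contAt_tangent hr q
  obtain ⟨hU_ne, hU_mem⟩ := hU.self_of_nhds
  rw [((hg.isUnitNormal t ht).isOrthonormal_normalize hU_ne hU_mem).hat_eq, inner_normalize_left,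
    hg.inner_tangent_normal_zero ht hU_mem, mul_zero, zero_smul]

lemma inner_normal_zero_eq (w : TangentSpace (𝓡 2) q) :
    (g t).inner q (N 0 q) w = (g 0).inner q (N 0 q) w := by
  have h_sub : Icc 0 t ⊆ Ico 0 ε := Icc_subset_Ico_right ht.2
  have h_const := eq_exp_integral_smul (P := fun _ ↦ 0) (f := fun s ↦ (g s).inner q (N 0 q) w)
    ht.1 continuousOn_const fun s hs ↦ by
      simpa [hg.hat_normal_zero (h_sub hs) hr] using
        (hg.hasDerivWithinAt s (h_sub hs) q (N 0 q) w).mono h_sub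
  simpa using h_const

lemma normal_eq : N t = N 0 := by
  funext q
  obtain ⟨U, -, hU⟩ := ℱ.exists_contAt_tangent hr q
  obtain ⟨hU_ne, hU_mem⟩ := hU.self_of_nhds
  have hN₀ := hg.isUnitNormal_zero ht
  have hNt := hg.isUnitNormal t ht
  have h_frame := hNt.isOrthonormal_normalize hU_ne hU_mem
  refine (hNt.eq_of_isOrthonormal h_frame ⟨h_frame.fst, ?_, ?_⟩ ?_).symm
  · rw [hg.inner_normal_zero_eq ht hr, hN₀.unit]
  · rw [inner_normalize_left, hg.inner_tangent_normal_zero ht hU_mem, mul_zero]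
  · rw [hg.inner_normal_zero_eq ht hr]
    exact hN₀.positive q

lemma nabla_normal_eq (q : M) :
    nabla (g t) (N t) q (N t q) =
      Real.exp (-∫ s in (0 : ℝ)..t, P s q) • nabla (g 0) (N 0) q (N 0 q) := by
  obtain ⟨U, hU, hU_tangent⟩ := ℱ.exists_contAt_tangent hr q
  obtain ⟨hU_ne, hU_mem⟩ := hU_tangent.self_of_nhds
  have hU_diff : VField.DiffAt U q := hU.mdifferentiableAt two_ne_zero
  have hU_mem_nhds := hU_tangent.mono fun x hx ↦ hx.2
  have hN₀ := hg.isUnitNormal_zero ht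
  have hNt : IsUnitNormal o (g t) (N 0) := hg.normal_eq ht hr ▸ hg.isUnitNormal t ht
  rw [hg.normal_eq ht hr]
  refine (hNt.isOrthonormal_normalize hU_ne hU_mem).ext_inner ?_ ?_
  · rw [inner_normalize_left, inner_normalize_left, map_smul,
      hg.inner_tangent_eq ht hU_mem (nabla (g 0) (N 0) q (N 0 q)),
      hN₀.inner_nabla_tangent hr hU_diff hU_mem_nhds,
      hNt.inner_nabla_tangent hr hU_diff hU_mem_nhds, hg.inner_normal_zero_eq ht hr,
      smul_eq_mul, ← mul_assoc (Real.exp _), ← Real.exp_add, neg_add_cancel, Real.exp_zero, one_mul]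
  · rw [map_smul, hg.inner_normal_zero_eq ht hr (nabla (g 0) (N 0) q (N 0 q)),
      hNt.inner_nabla_self hr, hN₀.inner_nabla_self hr, smul_zero]

end IsLeafwiseConformalFlow

namespace IsEGF

variable {ψ : ℝ × ℝ → ℝ} (hg : IsEGF o ψ ε g N)
include hg

lemma contDiffOn_inner (u v : TangentSpace (𝓡 2) q) :
    ContDiffOn ℝ 2 (fun s ↦ (g s).inner q u v) (Ico 0 ε) := by
  have h_line : ContMDiffOn 𝓘(ℝ, ℝ) (𝓘(ℝ, ℝ).prod (𝓡 2)) 2 (fun s : ℝ ↦ (s, q)) (Ico 0 ε) :=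
    contMDiffOn_id.prodMk contMDiffOn_const
  have h_apply := ContMDiffOn.clm_bundle_apply₂ (F₁ := Plane) (F₂ := Plane) (F₃ := ℝ)
    (E₁ := fun p : M ↦ TangentSpace (𝓡 2) p) (E₂ := fun p : M ↦ TangentSpace (𝓡 2) p)
    (E₃ := fun _ ↦ ℝ) (b := fun _ : ℝ ↦ q) (v := fun _ ↦ u) (w := fun _ ↦ v)
    (hg.contMDiffOn.comp h_line fun s hs ↦ ⟨hs, trivial⟩) contMDiffOn_const contMDiffOn_const
  exact contMDiffOn_iff_contDiffOn.1 fun s hs ↦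
    (Bundle.contMDiffWithinAt_totalSpace.1 (h_apply s hs)).2

lemma continuousOn_speed (hr : 3 ≤ r) (q : M) :
    ContinuousOn (fun s ↦ ψ (geodCurvature (g s) (N s) q, s)) (Ico 0 ε) := by
  obtain ⟨U, -, hU⟩ := ℱ.exists_contAt_tangent hr q
  obtain ⟨hU_ne, hU_mem⟩ := hU.self_of_nhds
  have h_pos (s : ℝ) : 0 < (g s).inner q (U q) (U q) := (g s).pos q _ hU_ne
  have h_smooth := hg.contDiffOn_inner (U q) (U q)
  have h_deriv := h_smooth.continuousOn_derivWithin (uniqueDiffOn_Ico 0 ε) one_le_two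
  refine (h_deriv.div h_smooth.continuousOn fun s _ ↦ (h_pos s).ne').congr fun s hs ↦ ?_
  rw [Pi.div_apply, (hg.hasDerivWithinAt s hs q (U q) (U q)).derivWithin
    (uniqueDiffOn_Ico 0 ε s hs), (hg.isUnitNormal s hs).inner_hat_hat hU_mem,
    mul_div_cancel_right₀ _ (h_pos s).ne']

lemma isLeafwiseConformalFlow (hr : 3 ≤ r) :
    IsLeafwiseConformalFlow o (fun s q ↦ ψ (geodCurvature (g s) (N s) q, s)) ε g N where
  continuousOn_speed := hg.continuousOn_speed hr
  isUnitNormal := hg.isUnitNormal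
  hasDerivWithinAt := hg.hasDerivWithinAt

end IsEGF

end Flow

end Foliation

end Surface

end FoliatedSurface

end

open FoliatedSurface in
theorem proposition5_general {M : Type*} [TopologicalSpace M] [ChartedSpace Plane M]
    [IsManifold (𝓡 2) ∞ M] {r : WithTop ℕ∞} (hr : 3 ≤ r) (ℱ : Foliation M r)
    (o : TransverseOrientation ℱ) (P : ℝ → M → ℝ) (ε : ℝ) (g : ℝ → Metric M) (N : ℝ → VField M)
    (hg : IsLeafwiseConformalFlow o P ε g N) (t : ℝ) (ht : t ∈ Set.Ico 0 ε) (p : M) :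
    gaussCurvature (g t) p =
      divergence (g t)
        (fun q ↦ Real.exp (-∫ s in (0 : ℝ)..t, P s q) • nabla (g 0) (N 0) q (N 0 q)) p
      + mvfderiv (𝓡 2) (geodCurvature (g t) (N t)) p (N 0 p)
      - geodCurvature (g t) (N t) p ^ 2 := by
  obtain ⟨T, hT⟩ := (hg.isUnitNormal t ht).exists_isFrameAt hr p
  simp only [hT.gaussCurvature_eq_divergence_add, hg.nabla_normal_eq ht hr,
    congrFun (hg.normal_eq ht hr) p]

open FoliatedSurface in
theorem proposition5 {M : Type*} [TopologicalSpace M] [ChartedSpace Plane M]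
    [IsManifold (𝓡 2) ∞ M] {r : WithTop ℕ∞} (hr : 3 ≤ r) (ℱ : Foliation M r)
    (o : TransverseOrientation ℱ) (ψ : ℝ × ℝ → ℝ) (hψ : ContDiff ℝ 2 ψ) (ε : ℝ)
    (g : ℝ → Metric M) (N : ℝ → VField M) (hg : IsEGF o ψ ε g N)
    (t : ℝ) (ht : t ∈ Set.Ico 0 ε) (p : M) :
    gaussCurvature (g t) p =
      divergence (g t)
        (fun q ↦ Real.exp (-∫ s in (0 : ℝ)..t, ψ (geodCurvature (g s) (N s) q, s)) •
          nabla (g 0) (N 0) q (N 0 q)) p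
      + mvfderiv (𝓡 2) (fun q ↦ geodCurvature (g t) (N t) q) p (N 0 p)
      - geodCurvature (g t) (N t) p ^ 2 :=
  proposition5_general hr ℱ o _ ε g N (hg.isLeafwiseConformalFlow hr) t ht p
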